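/- Let $R$ be a commutative ring with identity and let $C$ be a semidualizing $R$-module, that is: $C$ has a projective resolution by finitely generated projective modules, the homothety map $R\to\operatorname{Hom}_R(C,C)$ is an isomorphism, and $\operatorname{Ext}_R^{n}(C,C)=0$ for all $n\ge 1$. Let $\mathrm{Ch}(R)$ be the category of ($\mathbb{Z}$-indexed) complexes of $R$-modules, with chain maps as morphisms. A module is called $C$-projective (resp. $C$-flat) if it is isomorphic to $C\otimes_R P$ with $P$ projective (resp. to $C\otimes_R F$ with $F$ flat). A complex is called projective (resp. $C$-projective, $C$-flat) if it is exact and all its cycle modules are projective (resp. $C$-projective, $C$-flat). Write $\widetilde{\mathcal P}$, $\widetilde{\mathcal P_C}$, $\widetilde{\mathcal F_C}$ for these three classes of complexes. An exact sequence $\mathbf L$ in $\mathrm{Ch}(R)$ is called $\operatorname{Hom}(-,\widetilde{\mathcal F_C})$-exact if the sequence of abelian groups $\operatorname{Hom}_{\mathrm{Ch}(R)}(\mathbf L,H)$ is exact for every $H\in\widetilde{\mathcal F_C}$. A complex $X$ is called $D_C$-projective if there is a $\operatorname{Hom}(-,\widetilde{\mathcal F_C})$-exact exact sequence $$\cdots\to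 P_1\to P_0\xrightarrow{f_0}Q_{-1}\to Q_{-2}\to\cdots$$ in $\mathrm{Ch}(R)$ with all $P_i\in\widetilde{\mathcal P}$, all $Q_i\in\widetilde{\mathcal P_C}$ and $X\cong\operatorname{Im} f_0$. Then a complex $X\in\mathrm{Ch}(R)$ is $D_C$-projective if and only if there exists a $\operatorname{Hom}(-,\widetilde{\mathcal F_C})$-exact exact sequence $$\cdots\to W_1\xrightarrow{\sigma_1}W_0\xrightarrow{\sigma_0}W_{-1}\to\cdots$$ in $\mathrm{Ch}(R)$ such that each $W_i$ ($i\in\mathbb Z$) lies in $\widetilde{\mathcal P}\cup\widetilde{\mathcal P_C}$ and $X\cong\operatorname{Coker}\sigma_1$. -/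

import Mathlib

open CategoryTheory CategoryTheory.Limits

universe u v w

/-- An `R`-module `C` is semidualizing if it has a projective resolution by finitely generated
modules, the homothety map `R → Hom_R(C, C)` is an isomorphism, and `Ext^n_R(C, C) = 0` for all
`n ≥ 1`. -/
structure IsSemidualizing {R : Type u} [CommRing R] (C : ModuleCat.{u} R) : Prop where
  exists_resolution : ∃ P : ProjectiveResolution C, ∀ n : ℕ, Module.Finite R (P.complex.X n)
  homothety_bijective : Function.Bijective (LinearMap.lsmul R C : R → (C →ₗ[R] C))
  ext_eq_zero : ∀ n : ℕ, 1 ≤ n → Subsingleton (Abelian.Ext C C n)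

/-- The class of projective `R`-modules. -/
def projectiveModules (R : Type u) [CommRing R] : ObjectProperty (ModuleCat.{u} R) :=
  fun M => Module.Projective R M

/-- The class of `C`-projective modules: those isomorphic to `C ⊗ P` with `P` projective. -/
def cProjectiveModules {R : Type u} [CommRing R] (C : ModuleCat.{u} R) :
    ObjectProperty (ModuleCat.{u} R) :=
  fun M => ∃ P : ModuleCat.{u} R, Module.Projective R P ∧
    Nonempty (M ≅ ModuleCat.of R (TensorProduct R C P))

/-- The class of `C`-flat modules: those isomorphic to `C ⊗ F` with `F` flat. -/
def cFlatModules {R : Type u} [CommRing R] (C : ModuleCat.{u} R) :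
    ObjectProperty (ModuleCat.{u} R) :=
  fun M => ∃ F : ModuleCat.{u} R, Module.Flat R F ∧
    Nonempty (M ≅ ModuleCat.of R (TensorProduct R C F))

/-- For a class `𝒳` of modules, the class of `𝒳`-complexes: the exact complexes
`⋯ ⟶ X (n + 1) ⟶ X n ⟶ X (n - 1) ⟶ ⋯` all of whose cycle modules lie in `𝒳`. -/
def complexesOf {R : Type u} [CommRing R] (𝒳 : ObjectProperty (ModuleCat.{u} R)) :
    ObjectProperty (ChainComplex (ModuleCat.{u} R) ℤ) :=
  fun X => X.Acyclic ∧ ∀ i : ℤ, 𝒳 (X.cycles i)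

/-- A sequence `⋯ ⟶ L (i + 1) ⟶ L i ⟶ L (i - 1) ⟶ ⋯` with zero composites in an abelian category
is `Hom(-, 𝓑)`-exact if for every `B` in `𝓑` the sequence of abelian groups
`⋯ ⟶ Hom(L (i - 1), B) ⟶ Hom(L i, B) ⟶ Hom(L (i + 1), B) ⟶ ⋯` is exact. -/
def IsHomExact {A : Type w} [Category.{v} A] [Abelian A] (𝓑 : ObjectProperty A)
    (L : ChainComplex A ℤ) : Prop :=
  ∀ B : A, 𝓑 B → ∀ i : ℤ,
    Function.Exact (fun φ : L.X (i - 1) ⟶ B => L.d i (i - 1) ≫ φ)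
      (fun φ : L.X i ⟶ B => L.d (i + 1) i ≫ φ)

/-- A complex `X` is `D_C`-projective if there is an exact sequence of complexes
`⋯ ⟶ E 1 ⟶ E 0 ⟶ E (-1) ⟶ E (-2) ⟶ ⋯`, `Hom(-, 𝓑)`-exact for `𝓑` the class of `C`-flat
complexes, with `E i` a projective complex for `i ≥ 0` and a `C`-projective complex for `i < 0`,
such that `X` is isomorphic to the image of `E 0 ⟶ E (-1)`. -/
def IsDCProjectiveComplex {R : Type u} [CommRing R] (C : ModuleCat.{u} R)
    (X : ChainComplex (ModuleCat.{u} R) ℤ) : Prop :=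
  ∃ E : ChainComplex (ChainComplex (ModuleCat.{u} R) ℤ) ℤ,
    E.Acyclic ∧ IsHomExact (complexesOf (cFlatModules C)) E ∧
    (∀ i : ℤ, 0 ≤ i → complexesOf (projectiveModules R) (E.X i)) ∧
    (∀ i : ℤ, i < 0 → complexesOf (cProjectiveModules C) (E.X i)) ∧
    Nonempty (X ≅ image (E.d 0 (-1)))

/-!
Call `X ⟂ B` the vanishing of `Extⁿ(X, B)` for all `n ≥ 1`.  Given a complex `W` as in the theorem,
its syzygies `Z` satisfy `Z ⟂ B` for all `C`-flat complexes `B`, by dimension shifting.  Hence `X`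
has a suitable left half, any projective resolution, and only a coresolution by `C`-projective
complexes has to be found.

Dualizing a resolution of `C` into `C` gives a coresolution of `R` by `C`-projective modules whose
cosyzygies `N` satisfy `N ⟂ B` for all `C`-flat modules `B`.  Tensoring it with projective modules
and taking direct sums of disks yields a class `𝒟` of complexes with the same orthogonality,
containing all projective complexes, each of whose members embeds into a `C`-projective complex with
cokernel in `𝒟`.  Let `𝒮` be the closure under extensions of `𝒟` together with the syzygies of `W`.
A syzygy of `W` embeds into some `W i`, which either is `C`-projective or lies in `𝒟`; in both cases
the syzygy embeds into a `C`-projective complex with cokernel in `𝒮`.  By the horseshoe lemma every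
object of `𝒮` has this property, and iterating it gives the right half of the sequence.
-/

universe w' w''

open CategoryTheory.Abelian

section ExtVanishing

variable {A : Type w} [Category.{v} A] [Abelian A] [HasExt.{w'} A]

/-- The relation `Extⁿ(X, B) = 0` for all `n ≥ 1`, often written `X ⟂ B`. -/
def ExtVanishes (X B : A) : Prop :=
  ∀ n : ℕ, Subsingleton (Ext X B (n + 1))

lemma subsingleton_ext_of_iso {X X' B : A} (e : X ≅ X') {n : ℕ} :
    Subsingleton (Ext X B n) → Subsingleton (Ext X' B n) := fun _ ↦
  have φ : Ext X' B n ≃+ Ext X B n :=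
    (((extFunctor n).mapIso e.op).app B).addCommGroupIsoToAddEquiv
  φ.subsingleton

section LowDegree

variable {S : ShortComplex A} (hS : S.ShortExact)
include hS

lemma exists_extension_of_subsingleton_ext {B : A} (h : Subsingleton (Ext S.X₃ B 1))
    (f : S.X₁ ⟶ B) : ∃ g : S.X₂ ⟶ B, S.f ≫ g = f := by
  obtain ⟨y, hy⟩ := Ext.contravariant_sequence_exact₁ hS B (Ext.mk₀ f) (add_zero 1)
    (Subsingleton.elim _ _)
  obtain ⟨g, rfl⟩ := (Ext.mk₀_bijective _ _).2 y
  rw [Ext.mk₀_comp_mk₀] at hy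
  exact ⟨g, (Ext.mk₀_bijective _ _).1 hy⟩

lemma exists_lift_of_subsingleton_ext {T : A} (h : Subsingleton (Ext T S.X₁ 1))
    (f : T ⟶ S.X₃) : ∃ g : T ⟶ S.X₂, g ≫ S.g = f := by
  obtain ⟨y, hy⟩ := Ext.covariant_sequence_exact₃ T hS (Ext.mk₀ f) (zero_add 1)
    (Subsingleton.elim _ _)
  obtain ⟨g, rfl⟩ := (Ext.mk₀_bijective _ _).2 y
  rw [Ext.mk₀_comp_mk₀] at hy
  exact ⟨g, (Ext.mk₀_bijective _ _).1 hy⟩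

lemma subsingleton_ext_one_of_exists_extension {B : A} (h : Subsingleton (Ext S.X₂ B 1))
    (hB : ∀ f : S.X₁ ⟶ B, ∃ g : S.X₂ ⟶ B, S.f ≫ g = f) : Subsingleton (Ext S.X₃ B 1) := by
  refine subsingleton_of_forall_eq 0 fun x ↦ ?_
  obtain ⟨y, rfl⟩ := Ext.contravariant_sequence_exact₃ hS B x (Subsingleton.elim _ _) (add_zero 1)
  obtain ⟨f, rfl⟩ := (Ext.mk₀_bijective _ _).2 y
  obtain ⟨g, rfl⟩ := hB f
  rw [← Ext.mk₀_comp_mk₀, ← Ext.comp_assoc_of_second_deg_zero, hS.extClass_comp, Ext.zero_comp]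

lemma subsingleton_ext_succ {B : A} {n : ℕ} (h₁ : Subsingleton (Ext S.X₁ B n))
    (h₂ : Subsingleton (Ext S.X₂ B (n + 1))) : Subsingleton (Ext S.X₃ B (n + 1)) := by
  refine subsingleton_of_forall_eq 0 fun x ↦ ?_
  obtain ⟨y, rfl⟩ := Ext.contravariant_sequence_exact₃ hS B x (Subsingleton.elim _ _) (add_comm 1 n)
  rw [Subsingleton.elim y 0, Ext.comp_zero]

end LowDegree

namespace ExtVanishes

lemma of_projective (P B : A) [Projective P] : ExtVanishes P B :=
  Ext.subsingleton_of_projective P B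

lemma of_iso {X X' B : A} (h : ExtVanishes X B) (e : X ≅ X') : ExtVanishes X' B :=
  fun n ↦ subsingleton_ext_of_iso e (h n)

lemma of_iso_target {X B B' : A} (h : ExtVanishes X B) (e : B ≅ B') : ExtVanishes X B' := fun n ↦
  have φ : Ext X B' (n + 1) ≃+ Ext X B (n + 1) :=
    ((extFunctorObj X (n + 1)).mapIso e.symm).addCommGroupIsoToAddEquiv
  have := h n
  φ.subsingleton

lemma of_dimension_shift {𝒯 : ObjectProperty A} {B : A}
    (h : ∀ X, 𝒯 X → ∃ S : ShortComplex A, S.ShortExact ∧ Nonempty (S.X₃ ≅ X) ∧ 𝒯 S.X₁ ∧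
      ExtVanishes S.X₂ B ∧ ∀ f : S.X₁ ⟶ B, ∃ g : S.X₂ ⟶ B, S.f ≫ g = f)
    {X : A} (hX : 𝒯 X) : ExtVanishes X B := by
  intro n
  induction n generalizing X with
  | zero =>
    obtain ⟨S, hS, ⟨e⟩, -, h₂, hB⟩ := h X hX
    exact subsingleton_ext_of_iso e (subsingleton_ext_one_of_exists_extension hS (h₂ 0) hB)
  | succ n ih =>
    obtain ⟨S, hS, ⟨e⟩, hS₁, h₂, -⟩ := h X hX
    exact subsingleton_ext_of_iso e (subsingleton_ext_succ hS (ih hS₁) (h₂ (n + 1)))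

variable {S : ShortComplex A} (hS : S.ShortExact) {B : A}
include hS

lemma of_shortExact₁ (h₂ : ExtVanishes S.X₂ B) (h₃ : ExtVanishes S.X₃ B) :
    ExtVanishes S.X₁ B := fun n ↦ by
  have := h₂ n
  have := h₃ (n + 1)
  refine subsingleton_of_forall_eq 0 fun x ↦ ?_
  obtain ⟨y, rfl⟩ := Ext.contravariant_sequence_exact₁ hS B x (add_comm 1 (n + 1))
    (Subsingleton.elim _ _)
  rw [Subsingleton.elim y 0, Ext.comp_zero]

lemma of_shortExact₂ (h₁ : ExtVanishes S.X₁ B) (h₃ : ExtVanishes S.X₃ B) :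
    ExtVanishes S.X₂ B := fun n ↦ by
  have := h₁ n
  have := h₃ n
  refine subsingleton_of_forall_eq 0 fun x ↦ ?_
  obtain ⟨y, rfl⟩ := Ext.contravariant_sequence_exact₂ hS B x (Subsingleton.elim _ _)
  rw [Subsingleton.elim y 0, Ext.comp_zero]

lemma of_shortExact₃ (h₁ : ExtVanishes S.X₁ B) (h₂ : ExtVanishes S.X₂ B)
    (hB : ∀ f : S.X₁ ⟶ B, ∃ g : S.X₂ ⟶ B, S.f ≫ g = f) : ExtVanishes S.X₃ B
  | 0 => subsingleton_ext_one_of_exists_extension hS (h₂ 0) hB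
  | n + 1 => subsingleton_ext_succ hS (h₁ n) (h₂ (n + 1))

lemma of_shortExact_target {X : A} (h₁ : ExtVanishes X S.X₁) (h₃ : ExtVanishes X S.X₃) :
    ExtVanishes X S.X₂ := fun n ↦ by
  have := h₁ n
  have := h₃ n
  refine subsingleton_of_forall_eq 0 fun x ↦ ?_
  obtain ⟨y, rfl⟩ := Ext.covariant_sequence_exact₂ X hS x (Subsingleton.elim _ _)
  rw [Subsingleton.elim y 0, Ext.zero_comp]

end ExtVanishes

end ExtVanishing

section Extensions

variable {A : Type w} [Category.{v} A] [Abelian A]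

lemma shortExact_cokernel_comp {X Y Z : A} (f : X ⟶ Y) (g : Y ⟶ Z) [Mono g] :
    (ShortComplex.mk (cokernel.map f (f ≫ g) (𝟙 X) g (by simp))
      (cokernel.map (f ≫ g) g f (𝟙 Z) (by simp)) (by ext; simp)).ShortExact := by
  have h := kernelCokernelCompSequence_exact f g
  have : Mono (cokernel.map f (f ≫ g) (𝟙 X) g (by simp)) :=
    (h.exact 2).mono_g ((isZero_kernel_of_mono g).eq_of_src _ _)
  have : Epi (cokernel.map (f ≫ g) g f (𝟙 Z) (by simp)) :=
    inferInstanceAs (Epi ((kernelCokernelCompSequence f g).map' 4 5))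
  exact { exact := h.exact 3 }

lemma shortExact_cokernel {S T : ShortComplex A} (hS : S.ShortExact) (hT : T.ShortExact)
    (φ : S ⟶ T) [Mono φ.τ₁] [Mono φ.τ₃] : (cokernel φ).ShortExact := by
  have := hT.epi_g
  let I : ShortComplex.SnakeInput A :=
    { L₀ := kernel φ
      L₁ := S
      L₂ := T
      L₃ := cokernel φ
      v₀₁ := kernel.ι φ
      v₁₂ := φ
      v₂₃ := cokernel.π φ
      h₀ := kernelIsKernel φ
      h₃ := cokernelIsCokernel φ
      L₁_exact := hS.exact
      epi_L₁_g := hS.epi_g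
      L₂_exact := hT.exact
      mono_L₂_f := hT.mono_f }
  have : Mono I.v₁₂.τ₃ := inferInstanceAs (Mono φ.τ₃)
  have h₀ : IsZero I.L₀.X₃ := KernelFork.IsLimit.isZero_of_mono I.h₀τ₃
  have hf : Mono I.L₃.f := I.L₂'_exact.mono_g (h₀.eq_of_src _ _)
  have : Epi I.L₂.g := hT.epi_g
  exact { exact := I.L₃_exact, mono_f := hf, epi_g := I.epi_L₃_g }

lemma horseshoe_mono [HasExt.{w'} A] {S : ShortComplex A} (hS : S.ShortExact) {Q₁ Q₃ : A}
    (f₁ : S.X₁ ⟶ Q₁) [Mono f₁] (f₃ : S.X₃ ⟶ Q₃) [Mono f₃] (h : Subsingleton (Ext S.X₃ Q₁ 1)) :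
    ∃ (f : S.X₂ ⟶ Q₁ ⊞ Q₃) (V : ShortComplex A), Mono f ∧ V.ShortExact ∧
      Nonempty (V.X₁ ≅ cokernel f₁) ∧ Nonempty (V.X₂ ≅ cokernel f) ∧
      Nonempty (V.X₃ ≅ cokernel f₃) := by
  obtain ⟨g, hg⟩ := exists_extension_of_subsingleton_ext hS h f₁
  let φ : S ⟶ .mk (biprod.inl : Q₁ ⟶ Q₁ ⊞ Q₃) biprod.snd biprod.inl_snd :=
    { τ₁ := f₁
      τ₂ := biprod.lift g (S.g ≫ f₃)
      τ₃ := f₃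
      comm₁₂ := by ext <;> simp [hg] }
  have : Mono φ.τ₁ := ‹Mono f₁›
  have : Mono φ.τ₃ := ‹Mono f₃›
  have := hS.mono_f
  exact ⟨φ.τ₂, cokernel φ, ShortComplex.mono_τ₂_of_exact_of_mono φ hS.exact,
    shortExact_cokernel hS (ShortComplex.Splitting.ofHasBinaryBiproduct Q₁ Q₃).shortExact φ,
    ⟨PreservesCokernel.iso ShortComplex.π₁ φ⟩, ⟨PreservesCokernel.iso ShortComplex.π₂ φ⟩,
    ⟨PreservesCokernel.iso ShortComplex.π₃ φ⟩⟩

/-- The objects that embed into an object of `𝓠` with cokernel in `𝒮`. -/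
def KernelOfEpi (𝓠 𝒮 : ObjectProperty A) : ObjectProperty A :=
  fun X ↦ ∃ (Q : A) (f : X ⟶ Q), Mono f ∧ 𝓠 Q ∧ 𝒮 (cokernel f)

lemma KernelOfEpi.of_shortExact {𝓠 𝒮 : ObjectProperty A} [𝒮.IsClosedUnderIsomorphisms]
    {S : ShortComplex A} (hS : S.ShortExact) (h₂ : 𝓠 S.X₂) (h₃ : 𝒮 S.X₃) :
    KernelOfEpi 𝓠 𝒮 S.X₁ :=
  ⟨S.X₂, S.f, hS.mono_f, h₂,
    𝒮.prop_of_iso (hS.gIsCokernel.coconePointUniqueUpToIso (colimit.isColimit _)) h₃⟩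

lemma KernelOfEpi.mono {𝓠 𝓠' 𝒮 𝒮' : ObjectProperty A} (h𝓠 : 𝓠 ≤ 𝓠') (h𝒮 : 𝒮 ≤ 𝒮') :
    KernelOfEpi 𝓠 𝒮 ≤ KernelOfEpi 𝓠' 𝒮' :=
  fun _ ⟨Q, f, hf, hQ, hf'⟩ ↦ ⟨Q, f, hf, h𝓠 _ hQ, h𝒮 _ hf'⟩

lemma KernelOfEpi.of_iso {𝓠 𝒮 : ObjectProperty A} [𝒮.IsClosedUnderIsomorphisms] {X Y : A}
    (e : X ≅ Y) : KernelOfEpi 𝓠 𝒮 X → KernelOfEpi 𝓠 𝒮 Y :=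
  fun ⟨Q, f, _, hQ, hf⟩ ↦
    ⟨Q, e.inv ≫ f, inferInstance, hQ, 𝒮.prop_of_iso (cokernelEpiComp e.inv f).symm hf⟩

/-- The smallest class of objects containing `𝒮` and closed under isomorphisms and extensions. -/
inductive ExtensionClosure (𝒮 : ObjectProperty A) : ObjectProperty A
  | of {X : A} : 𝒮 X → ExtensionClosure 𝒮 X
  | of_iso {X Y : A} (e : X ≅ Y) : ExtensionClosure 𝒮 X → ExtensionClosure 𝒮 Y
  | extension {S : ShortComplex A} (hS : S.ShortExact) :
      ExtensionClosure 𝒮 S.X₁ → ExtensionClosure 𝒮 S.X₃ → ExtensionClosure 𝒮 S.X₂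

namespace ExtensionClosure

variable {𝒮 𝓠 : ObjectProperty A}

instance : (ExtensionClosure 𝒮).IsClosedUnderIsomorphisms where
  of_iso e h := h.of_iso e

lemma extVanishes [HasExt.{w'} A] {B : A} (h : ∀ X, 𝒮 X → ExtVanishes X B) {X : A}
    (hX : ExtensionClosure 𝒮 X) : ExtVanishes X B := by
  induction hX with
  | of hX => exact h _ hX
  | of_iso e _ ih => exact ih.of_iso e
  | extension hS _ _ ih₁ ih₃ => exact .of_shortExact₂ hS ih₁ ih₃

lemma le_kernelOfEpi [HasExt.{w'} A] (h𝓠 : ∀ Q₁ Q₂, 𝓠 Q₁ → 𝓠 Q₂ → 𝓠 (Q₁ ⊞ Q₂))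
    (hExt : ∀ X Q, 𝒮 X → 𝓠 Q → ExtVanishes X Q) (h𝒮 : 𝒮 ≤ KernelOfEpi 𝓠 (ExtensionClosure 𝒮)) :
    ExtensionClosure 𝒮 ≤ KernelOfEpi 𝓠 (ExtensionClosure 𝒮) := by
  intro X hX
  induction hX with
  | of hX => exact h𝒮 _ hX
  | of_iso e _ ih => exact .of_iso e ih
  | extension hS _ h₃ ih₁ ih₃ =>
    obtain ⟨Q₁, f₁, _, hQ₁, hf₁⟩ := ih₁
    obtain ⟨Q₃, f₃, _, hQ₃, hf₃⟩ := ih₃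
    obtain ⟨f, V, hf, hV, ⟨e₁⟩, ⟨e₂⟩, ⟨e₃⟩⟩ :=
      horseshoe_mono hS f₁ f₃ (h₃.extVanishes (fun X hX ↦ hExt X Q₁ hX hQ₁) 0)
    exact ⟨_, f, hf, h𝓠 _ _ hQ₁ hQ₃, .of_iso e₂ (.extension hV (hf₁.of_iso e₁.symm)
      (hf₃.of_iso e₃.symm))⟩

lemma kernelOfEpi_of_shortExact {S : ShortComplex A} (hS : S.ShortExact)
    (h₂ : KernelOfEpi 𝓠 (ExtensionClosure 𝒮) S.X₂) (h₃ : ExtensionClosure 𝒮 S.X₃) :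
    KernelOfEpi 𝓠 (ExtensionClosure 𝒮) S.X₁ := by
  obtain ⟨Q, f, _, hQ, hf⟩ := h₂
  have := hS.mono_f
  have e : S.X₃ ≅ cokernel S.f :=
    hS.gIsCokernel.coconePointUniqueUpToIso (colimit.isColimit _)
  exact ⟨Q, S.f ≫ f, inferInstance, hQ,
    .extension (shortExact_cokernel_comp S.f f) (h₃.of_iso e) hf⟩

end ExtensionClosure

end Extensions

section Cycles

variable {A : Type w} [Category.{v} A] [Abelian A] {ι : Type*} {c : ComplexShape ι}
  {K : HomologicalComplex A c} {i j k : ι}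

variable (i j) in
lemma iCycles_toCycles : K.iCycles i ≫ K.toCycles i j = 0 := by
  rw [← cancel_mono (K.iCycles j), Category.assoc, K.toCycles_i, K.iCycles_d, zero_comp]

variable (i j) in
lemma fromOpcycles_pOpcycles : K.fromOpcycles i j ≫ K.pOpcycles j = 0 := by
  rw [← cancel_epi (K.pOpcycles i), K.p_fromOpcycles_assoc, K.d_pOpcycles, comp_zero]

lemma epi_toCycles_of_exactAt (hij : c.Rel i j) (hj : K.ExactAt j) : Epi (K.toCycles i j) := by
  have : Epi (K.opcyclesToCycles i j) :=
    ((HomologicalComplex.HomologySequence.composableArrows₃_exact K i j hij).exact 1).epi_f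
      (hj.isZero_homology.eq_of_tgt _ _)
  rw [← K.pOpcycles_opcyclesToCycles i j]
  infer_instance

lemma mono_fromOpcycles_of_exactAt (hij : c.Rel i j) (hi : K.ExactAt i) :
    Mono (K.fromOpcycles i j) := by
  have : Mono (K.opcyclesToCycles i j) :=
    ((HomologicalComplex.HomologySequence.composableArrows₃_exact K i j hij).exact 0).mono_g
      (hi.isZero_homology.eq_of_src _ _)
  rw [← K.opcyclesToCycles_iCycles i j]
  infer_instance

lemma shortExact_cycles (hij : c.Rel i j) (hj : K.ExactAt j) :
    (ShortComplex.mk (K.iCycles i) (K.toCycles i j) (iCycles_toCycles i j)).ShortExact where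
  exact := by
    let φ : ShortComplex.mk _ _ (iCycles_toCycles i j) ⟶ ShortComplex.mk _ _ (K.iCycles_d i j) :=
      { τ₁ := 𝟙 _, τ₂ := 𝟙 _, τ₃ := K.iCycles j }
    have : Epi φ.τ₁ := inferInstanceAs (Epi (𝟙 _))
    have : IsIso φ.τ₂ := inferInstanceAs (IsIso (𝟙 _))
    have : Mono φ.τ₃ := inferInstanceAs (Mono (K.iCycles j))
    exact (ShortComplex.exact_iff_of_epi_of_isIso_of_mono φ).2
      (ShortComplex.exact_of_f_is_kernel _ (K.cyclesIsKernel i j (c.next_eq' hij)))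
  mono_f := inferInstanceAs (Mono (K.iCycles i))
  epi_g := epi_toCycles_of_exactAt hij hj

lemma shortExact_opcycles (hij : c.Rel i j) (hi : K.ExactAt i) :
    (ShortComplex.mk (K.fromOpcycles i j) (K.pOpcycles j)
      (fromOpcycles_pOpcycles i j)).ShortExact where
  exact := by
    let φ : ShortComplex.mk _ _ (K.d_pOpcycles i j) ⟶
        ShortComplex.mk _ _ (fromOpcycles_pOpcycles i j) :=
      { τ₁ := K.pOpcycles i, τ₂ := 𝟙 _, τ₃ := 𝟙 _ }
    have : Epi φ.τ₁ := inferInstanceAs (Epi (K.pOpcycles i))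
    have : IsIso φ.τ₂ := inferInstanceAs (IsIso (𝟙 _))
    have : Mono φ.τ₃ := inferInstanceAs (Mono (𝟙 _))
    exact (ShortComplex.exact_iff_of_epi_of_isIso_of_mono φ).1
      (ShortComplex.exact_of_g_is_cokernel _ (K.opcyclesIsCokernel i j (c.prev_eq' hij)))
  mono_f := mono_fromOpcycles_of_exactAt hij hi
  epi_g := inferInstanceAs (Epi (K.pOpcycles j))

lemma nonempty_cycles_iso_image (hij : c.Rel i j) (hj : K.ExactAt j) :
    Nonempty (K.cycles j ≅ image (K.d i j)) := by
  have := epi_toCycles_of_exactAt hij hj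
  have := strongEpi_of_epi (K.toCycles i j)
  exact ⟨image.isoStrongEpiMono (K.toCycles i j) (K.iCycles j) (K.toCycles_i i j)⟩

lemma nonempty_cycles_iso_cokernel (hki : c.Rel k i) (hij : c.Rel i j) (hi : K.ExactAt i)
    (hj : K.ExactAt j) : Nonempty (K.cycles j ≅ cokernel (K.d k i)) := by
  have hk := epi_toCycles_of_exactAt hki hi
  have := (shortExact_cycles hij hj).gIsCokernel.coconePointUniqueUpToIso
    (colimit.isColimit _)
  exact ⟨this ≪≫ (cokernelEpiComp (K.toCycles k i) (K.iCycles i)).symm ≪≫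
    cokernelIsoOfEq (K.toCycles_i k i)⟩

instance : (HomologicalComplex.cyclesFunctor A c i).Additive where
  map_add {_ _ f g} :=
    let F := HomologicalComplex.shortComplexFunctor A c i
    ShortComplex.cyclesMap_add (F.map f) (F.map g)

end Cycles

section HomExact

variable {A : Type w} [Category.{v} A] [Abelian A] {𝓑 : ObjectProperty A}

namespace IsHomExact

variable {L : ChainComplex A ℤ} (hL : IsHomExact 𝓑 L) {B : A} (hB : 𝓑 B)
include hL hB

lemma exists_factor {i j k : ℤ} (hij : j + 1 = i) (hki : i + 1 = k) (f : L.X i ⟶ B)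
    (hf : L.d k i ≫ f = 0) : ∃ g : L.X j ⟶ B, L.d i j ≫ g = f := by
  obtain rfl : j = i - 1 := by lia
  subst hki
  exact (hL B hB i f).1 hf

lemma exists_extension_of_cycles (hL' : L.Acyclic) (j : ℤ) (f : L.cycles j ⟶ B) :
    ∃ g : L.X j ⟶ B, L.iCycles j ≫ g = f := by
  have := epi_toCycles_of_exactAt (i := j + 1) rfl (hL' j)
  obtain ⟨g, hg⟩ := hL.exists_factor hB (j := j) rfl rfl (L.toCycles (j + 1) j ≫ f) (by
    rw [← Category.assoc, L.d_toCycles, zero_comp])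
  refine ⟨g, ?_⟩
  rw [← cancel_epi (L.toCycles (j + 1) j), ← hg, ← Category.assoc, L.toCycles_i]

lemma extVanishes_cycles [HasExt.{w'} A] (hL' : L.Acyclic)
    (h : ∀ i, ExtVanishes (L.X i) B) (j : ℤ) : ExtVanishes (L.cycles j) B := by
  refine .of_dimension_shift (𝒯 := fun Z ↦ ∃ j, Nonempty (L.cycles j ≅ Z)) ?_ ⟨j, ⟨Iso.refl _⟩⟩
  rintro Z ⟨j, ⟨e⟩⟩
  exact ⟨_, shortExact_cycles (i := j + 1) rfl (hL' j), ⟨e⟩, ⟨_, ⟨Iso.refl _⟩⟩, h _,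
    hL.exists_extension_of_cycles hB hL' _⟩

end IsHomExact

lemma isHomExact_iff {L : ChainComplex A ℤ} :
    IsHomExact 𝓑 L ↔ ∀ (B : A), 𝓑 B → ∀ (j : ℤ) (f : L.X (j + 1) ⟶ B),
      L.d (j + 1 + 1) (j + 1) ≫ f = 0 → ∃ g : L.X j ⟶ B, L.d (j + 1) j ≫ g = f := by
  refine ⟨fun h B hB j f hf ↦ h.exists_factor hB rfl rfl f hf, fun h B hB i f ↦ ⟨fun hf ↦ ?_, ?_⟩⟩
  · obtain ⟨j, rfl⟩ : ∃ j, i = j + 1 := ⟨i - 1, by lia⟩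
    have hj : j + 1 - 1 = j := by lia
    rw [Set.mem_range, hj]
    exact h B hB j f hf
  · rintro ⟨g, rfl⟩
    change L.d (i + 1) i ≫ L.d i (i - 1) ≫ g = 0
    rw [L.d_comp_d_assoc, zero_comp]

end HomExact

section Splice

variable {A : Type w} [Category.{v} A] [Abelian A]

lemma exact_of_eq_comp {S : ShortComplex A} (hS : S.Exact) {W Z : A} {f : W ⟶ S.X₂} {g : S.X₂ ⟶ Z}
    (w : f ≫ g = 0) (p : W ⟶ S.X₁) [Epi p] (m : S.X₃ ⟶ Z) [Mono m] (hf : f = p ≫ S.f)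
    (hg : g = S.g ≫ m) : (ShortComplex.mk f g w).Exact := by
  let T : ShortComplex A := .mk (p ≫ S.f) S.g (by simp)
  let φ : T ⟶ S := { τ₁ := p, τ₂ := 𝟙 _, τ₃ := 𝟙 _ }
  let ψ : T ⟶ .mk f g w := { τ₁ := 𝟙 _, τ₂ := 𝟙 _, τ₃ := m }
  have : Epi φ.τ₁ := ‹Epi p›
  have : IsIso φ.τ₂ := inferInstanceAs (IsIso (𝟙 _))
  have : Mono φ.τ₃ := inferInstanceAs (Mono (𝟙 _))
  have : Epi ψ.τ₁ := inferInstanceAs (Epi (𝟙 _))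
  have : IsIso ψ.τ₂ := inferInstanceAs (IsIso (𝟙 _))
  have : Mono ψ.τ₃ := ‹Mono m›
  exact (ShortComplex.exact_iff_of_epi_of_isIso_of_mono ψ).1
    ((ShortComplex.exact_iff_of_epi_of_isIso_of_mono φ).2 hS)

lemma exists_factor_of_subsingleton_ext [HasExt.{w'} A] {S T : ShortComplex A} (hS : S.ShortExact)
    (hT : T.ShortExact) (e : T.X₃ ≅ S.X₁) {B : A} (h : Subsingleton (Ext S.X₃ B 1))
    (f : T.X₂ ⟶ B) (hf : T.f ≫ f = 0) : ∃ g : S.X₂ ⟶ B, (T.g ≫ e.hom ≫ S.f) ≫ g = f := by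
  obtain ⟨f', hf'⟩ := CokernelCofork.IsColimit.desc' hT.gIsCokernel f hf
  obtain ⟨g, hg⟩ := exists_extension_of_subsingleton_ext hS h (e.inv ≫ f')
  refine ⟨g, ?_⟩
  rw [Category.assoc, Category.assoc, hg, e.hom_inv_id_assoc]
  exact hf'

variable {S : ℤ → ShortComplex A}

/-- The complex `⋯ ⟶ (S 1).X₂ ⟶ (S 0).X₂ ⟶ (S (-1)).X₂ ⟶ ⋯` obtained by splicing short complexes
along isomorphisms between the end of `S (i + 1)` and the beginning of `S i`. -/
noncomputable def spliceComplex (e : ∀ i, (S (i + 1)).X₃ ≅ (S i).X₁) : ChainComplex A ℤ :=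
  ChainComplex.of (fun i ↦ (S i).X₂) (fun i ↦ (S (i + 1)).g ≫ (e i).hom ≫ (S i).f)
    fun i ↦ by simp

variable (e : ∀ i, (S (i + 1)).X₃ ≅ (S i).X₁)

lemma spliceComplex_d (i : ℤ) :
    (spliceComplex e).d (i + 1) i = (S (i + 1)).g ≫ (e i).hom ≫ (S i).f :=
  ChainComplex.of_d (X := fun i ↦ (S i).X₂) (d := fun i ↦ (S (i + 1)).g ≫ (e i).hom ≫ (S i).f) i

variable (hS : ∀ i, (S i).ShortExact)
include hS

lemma acyclic_spliceComplex : (spliceComplex e).Acyclic := by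
  intro i
  obtain ⟨j, rfl⟩ : ∃ j, i = j + 1 := ⟨i - 1, by lia⟩
  have := (hS (j + 1 + 1)).epi_g
  have := (hS j).mono_f
  rw [HomologicalComplex.exactAt_iff' _ (j + 1 + 1) (j + 1) j
    ((ComplexShape.down ℤ).prev_eq' rfl) ((ComplexShape.down ℤ).next_eq' rfl)]
  exact exact_of_eq_comp (W := (S (j + 1 + 1)).X₂) (Z := (S j).X₂) (hS (j + 1)).exact _
    ((S (j + 1 + 1)).g ≫ (e (j + 1)).hom)
    ((e j).hom ≫ (S j).f) ((spliceComplex_d e _).trans (Category.assoc _ _ _).symm)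
    (spliceComplex_d e j)

lemma nonempty_iso_image_spliceComplex (i : ℤ) :
    Nonempty ((S (i + 1)).X₃ ≅ image ((spliceComplex e).d (i + 1) i)) := by
  have := (hS (i + 1)).epi_g
  have := (hS i).mono_f
  have : StrongEpi (S (i + 1)).g := strongEpi_of_epi _
  exact ⟨image.isoStrongEpiMono (X := (S (i + 1)).X₂) (Y := (S i).X₂) (S (i + 1)).g
    ((e i).hom ≫ (S i).f) (spliceComplex_d e i).symm⟩

lemma isHomExact_spliceComplex [HasExt.{w'} A] {𝓑 : ObjectProperty A}
    (h : ∀ i B, 𝓑 B → Subsingleton (Ext (S i).X₃ B 1)) : IsHomExact 𝓑 (spliceComplex e) := by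
  rw [isHomExact_iff]
  intro B hB j (f : (S (j + 1)).X₂ ⟶ B) hf
  have := (hS (j + 1 + 1)).epi_g
  have hd : ((S (j + 1 + 1)).g ≫ (e (j + 1)).hom ≫ (S (j + 1)).f) ≫ f = 0 :=
    (congrArg (· ≫ f) (spliceComplex_d e (j + 1))).symm.trans hf
  have hf' : (S (j + 1)).f ≫ f = 0 := by
    rw [← cancel_epi (e (j + 1)).hom, ← cancel_epi (S (j + 1 + 1)).g, comp_zero, comp_zero]
    simpa only [Category.assoc] using hd
  obtain ⟨g, hg⟩ := exists_factor_of_subsingleton_ext (hS j) (hS (j + 1)) (e j) (h j B hB) f hf'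
  exact ⟨g, (congrArg (· ≫ g) (spliceComplex_d e j)).trans hg⟩

end Splice

lemma exists_int_sequence {α : Type*} {p q : α → Prop} {r : α → α → Prop}
    (hp : ∀ a, p a → ∃ b, p b ∧ r b a) (hq : ∀ a, q a → ∃ b, q b ∧ r a b) {a b : α} (ha : p a)
    (hb : q b) (hab : r a b) :
    ∃ s : ℤ → α, s 0 = a ∧ (∀ i, r (s (i + 1)) (s i)) ∧ (∀ i, 0 ≤ i → p (s i)) ∧
      ∀ i < 0, q (s i) := by
  choose f hpf hrf using hp
  choose g hqg hrg using hq
  let F (n : ℕ) : {x // p x} := (fun x ↦ ⟨f x.1 x.2, hpf x.1 x.2⟩)^[n] ⟨a, ha⟩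
  let G (n : ℕ) : {x // q x} := (fun x ↦ ⟨g x.1 x.2, hqg x.1 x.2⟩)^[n] ⟨b, hb⟩
  have hF (n : ℕ) : r (F (n + 1)) (F n) := by
    simp only [F, Function.iterate_succ_apply']
    exact hrf _ _
  have hG (n : ℕ) : r (G n) (G (n + 1)) := by
    simp only [G, Function.iterate_succ_apply']
    exact hrg _ _
  let s : ℤ → α
    | .ofNat n => F n
    | .negSucc n => G n
  refine ⟨s, rfl, ?_, ?_, ?_⟩
  · rintro (n | _ | n)
    exacts [hF n, hab, hG n]
  · rintro (n | n) h
    exacts [(F n).2, absurd h (by simp)]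
  · rintro (n | n) h
    exacts [absurd h (by simp), (G n).2]

section CompleteResolution

variable {A : Type w} [Category.{v} A] [Abelian A]

/-- `X` is a syzygy, namely the image of `E 0 ⟶ E (-1)`, of a `Hom(-, 𝓑)`-exact acyclic complex
with terms in `𝓟` in non-negative degrees and terms in `𝓠` in negative degrees. -/
def HasCompleteResolution (𝓟 𝓠 𝓑 : ObjectProperty A) (X : A) : Prop :=
  ∃ E : ChainComplex A ℤ, E.Acyclic ∧ IsHomExact 𝓑 E ∧ (∀ i : ℤ, 0 ≤ i → 𝓟 (E.X i)) ∧
    (∀ i : ℤ, i < 0 → 𝓠 (E.X i)) ∧ Nonempty (X ≅ image (E.d 0 (-1)))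

variable [HasExt.{w'} A] {𝓟 𝓠 𝓑 𝒮 : ObjectProperty A}

theorem hasCompleteResolution_of_le_kernelOfEpi (h𝓟 : ∀ P, 𝓟 P → Projective P)
    (h𝓟' : ∀ X, ∃ (P : A) (p : P ⟶ X), 𝓟 P ∧ Epi p) (h𝒮 : 𝒮 ≤ KernelOfEpi 𝓠 𝒮)
    (hExt : ∀ X B, 𝒮 X → 𝓑 B → ExtVanishes X B) {X : A} (hX : 𝒮 X) :
    HasCompleteResolution 𝓟 𝓠 𝓑 X := by
  let p (S : ShortComplex A) : Prop :=
    S.ShortExact ∧ 𝓟 S.X₂ ∧ ∀ B, 𝓑 B → ExtVanishes S.X₁ B ∧ ExtVanishes S.X₃ B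
  let q (S : ShortComplex A) : Prop := S.ShortExact ∧ 𝓠 S.X₂ ∧ 𝒮 S.X₃
  have exists_p (Y : A) (hY : ∀ B, 𝓑 B → ExtVanishes Y B) : ∃ S, p S ∧ S.X₃ = Y := by
    obtain ⟨P, π, hP, _⟩ := h𝓟' Y
    have := h𝓟 P hP
    have hS : (ShortComplex.mk (kernel.ι π) π (kernel.condition π)).ShortExact :=
      { exact := ShortComplex.exact_kernel π }
    exact ⟨_, ⟨hS, hP, fun B hB ↦
      ⟨.of_shortExact₁ hS (.of_projective P B) (hY B hB), hY B hB⟩⟩, rfl⟩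
  have exists_q (Y : A) (hY : 𝒮 Y) : ∃ S, q S ∧ S.X₁ = Y := by
    obtain ⟨Q, f, _, hQ, hf⟩ := h𝒮 Y hY
    have hS : (ShortComplex.mk f (cokernel.π f) (cokernel.condition f)).ShortExact :=
      { exact := ShortComplex.exact_cokernel f }
    exact ⟨_, ⟨hS, hQ, hf⟩, rfl⟩
  obtain ⟨S₀, hS₀, h₀⟩ := exists_p X fun B hB ↦ hExt X B hX hB
  obtain ⟨T₀, hT₀, h₁⟩ := exists_q X hX
  obtain ⟨S, rfl, he, hp, hq⟩ := exists_int_sequence (p := p) (q := q)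
    (r := fun S T ↦ Nonempty (S.X₃ ≅ T.X₁))
    (fun S hS ↦ (exists_p S.X₁ fun B hB ↦ (hS.2.2 B hB).1).imp fun T hT ↦ ⟨hT.1, ⟨eqToIso hT.2⟩⟩)
    (fun S hS ↦ (exists_q S.X₃ hS.2.2).imp fun T hT ↦ ⟨hT.1, ⟨eqToIso hT.2.symm⟩⟩)
    hS₀ hT₀ ⟨eqToIso (h₀.trans h₁.symm)⟩
  replace he (i : ℤ) : (S (i + 1)).X₃ ≅ (S i).X₁ := (he i).some
  have hS (i : ℤ) : (S i).ShortExact :=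
    (le_or_gt 0 i).elim (fun h ↦ (hp i h).1) (fun h ↦ (hq i h).1)
  have hS' (i : ℤ) (B : A) (hB : 𝓑 B) : ExtVanishes (S i).X₃ B :=
    (le_or_gt 0 i).elim (fun h ↦ ((hp i h).2.2 B hB).2) fun h ↦ hExt _ B (hq i h).2.2 hB
  obtain ⟨e⟩ := nonempty_iso_image_spliceComplex he hS (-1)
  exact ⟨spliceComplex he, acyclic_spliceComplex he hS,
    isHomExact_spliceComplex he hS fun i B hB ↦ hS' i B hB 0, fun i hi ↦ (hp i hi).2.1,
    fun i hi ↦ (hq i hi).2.1, ⟨eqToIso h₀.symm ≪≫ e⟩⟩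

theorem hasCompleteResolution_cycles {𝒟 : ObjectProperty A} (h𝓟 : ∀ P, 𝓟 P → Projective P)
    (h𝓟' : ∀ X, ∃ (P : A) (p : P ⟶ X), 𝓟 P ∧ Epi p)
    (h𝓠 : ∀ Q₁ Q₂, 𝓠 Q₁ → 𝓠 Q₂ → 𝓠 (Q₁ ⊞ Q₂)) (h𝓠𝓑 : 𝓠 ≤ 𝓑)
    (hExt𝓠 : ∀ Q B, 𝓠 Q → 𝓑 B → ExtVanishes Q B) (h𝓟𝒟 : 𝓟 ≤ 𝒟) (h𝒟 : 𝒟 ≤ KernelOfEpi 𝓠 𝒟)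
    (hExt𝒟 : ∀ D B, 𝒟 D → 𝓑 B → ExtVanishes D B) {W : ChainComplex A ℤ} (hW : W.Acyclic)
    (hW' : IsHomExact 𝓑 W) (hPQ : ∀ i, 𝓟 (W.X i) ∨ 𝓠 (W.X i)) (j : ℤ) :
    HasCompleteResolution 𝓟 𝓠 𝓑 (W.cycles j) := by
  let 𝒮 : ObjectProperty A := fun X ↦ (∃ i, Nonempty (W.cycles i ≅ X)) ∨ 𝒟 X
  have hExt (X B : A) (hX : 𝒮 X) (hB : 𝓑 B) : ExtVanishes X B := by
    obtain ⟨i, ⟨e⟩⟩ | hX := hX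
    · refine (hW'.extVanishes_cycles hB hW (fun k ↦ ?_) i).of_iso e
      exact (hPQ k).elim (fun h ↦ have := h𝓟 _ h; .of_projective _ _) fun h ↦ hExt𝓠 _ B h hB
    · exact hExt𝒟 X B hX hB
  refine hasCompleteResolution_of_le_kernelOfEpi h𝓟 h𝓟' (ExtensionClosure.le_kernelOfEpi h𝓠
    (fun X Q hX hQ ↦ hExt X Q hX (h𝓠𝓑 Q hQ)) ?_)
    (fun X B hX hB ↦ hX.extVanishes fun Y hY ↦ hExt Y B hY hB) (.of (.inl ⟨j, ⟨Iso.refl _⟩⟩))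
  rintro X (⟨i, ⟨e⟩⟩ | hX)
  · refine KernelOfEpi.of_iso e ?_
    have hS := shortExact_cycles (i := i) (j := i - 1) (by simp) (hW (i - 1))
    have h₃ : ExtensionClosure 𝒮 (W.cycles (i - 1)) := .of (.inl ⟨_, ⟨Iso.refl _⟩⟩)
    obtain hP | hQ := hPQ i
    · exact ExtensionClosure.kernelOfEpi_of_shortExact hS
        (.mono le_rfl (fun _ h ↦ .of (.inr h)) _ (h𝒟 _ (h𝓟𝒟 _ hP))) h₃
    · exact KernelOfEpi.of_shortExact hS hQ h₃
  · exact .mono le_rfl (fun _ h ↦ .of (.inr h)) _ (h𝒟 X hX)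

end CompleteResolution

section DiskSum

variable {A : Type w} [Category.{v} A] [Abelian A]

lemma shortExact_of_eq_biprod_map {S T : ShortComplex A} (hS : S.ShortExact) (hT : T.ShortExact)
    {f : S.X₁ ⊞ T.X₁ ⟶ S.X₂ ⊞ T.X₂} {g : S.X₂ ⊞ T.X₂ ⟶ S.X₃ ⊞ T.X₃} (hf : f = biprod.map S.f T.f)
    (hg : g = biprod.map S.g T.g) (w : f ≫ g = 0) : (ShortComplex.mk f g w).ShortExact := by
  subst hf hg
  have := hS.mono_f
  have := hS.epi_g
  have := hT.mono_f
  have := hT.epi_g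
  refine { exact := ?_ }
  rw [ShortComplex.exact_iff_exact_up_to_refinements]
  intro B t (ht : t ≫ biprod.map S.g T.g = 0)
  obtain ⟨x, hx⟩ := KernelFork.IsLimit.lift' hS.fIsKernel (t ≫ biprod.fst)
    (by simpa using congr($ht ≫ biprod.fst))
  obtain ⟨y, hy⟩ := KernelFork.IsLimit.lift' hT.fIsKernel (t ≫ biprod.snd)
    (by simpa using congr($ht ≫ biprod.snd))
  dsimp at hx hy
  refine ⟨B, 𝟙 B, inferInstance, biprod.lift x y, ?_⟩
  change 𝟙 B ≫ t = biprod.lift x y ≫ biprod.map S.f T.f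
  ext <;> simp [hx, hy]

lemma shortExact_biprod (X Y : A) :
    (ShortComplex.mk (biprod.inl : X ⟶ X ⊞ Y) biprod.snd biprod.inl_snd).ShortExact :=
  (ShortComplex.Splitting.ofHasBinaryBiproduct X Y).shortExact

/-- The direct sum of the disk complexes `⋯ ⟶ 0 ⟶ N i ⟶ N i ⟶ 0 ⟶ ⋯` in degrees `i` and `i - 1`,
encoded as the splice of the split sequences `N (i + 1) ⟶ N (i + 1) ⊞ N i ⟶ N i`. -/
noncomputable def diskSum (N : ℤ → A) : ChainComplex A ℤ :=
  spliceComplex (S := fun i ↦ .mk (biprod.inl : N (i + 1) ⟶ N (i + 1) ⊞ N i) biprod.snd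
    biprod.inl_snd) fun _ ↦ Iso.refl _

namespace diskSum

variable (N : ℤ → A)

/-- The inclusion of the cycles. -/
noncomputable def ι (i : ℤ) : N (i + 1) ⟶ (diskSum N).X i :=
  (biprod.inl : N (i + 1) ⟶ N (i + 1) ⊞ N i)

/-- The projection onto the cycles one degree below. -/
noncomputable def π (i : ℤ) : (diskSum N).X i ⟶ N i :=
  (biprod.snd : N (i + 1) ⊞ N i ⟶ N i)

/-- The canonical section of `diskSum.π`. -/
noncomputable def σ (i : ℤ) : N i ⟶ (diskSum N).X i :=
  (biprod.inr : N i ⟶ N (i + 1) ⊞ N i)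

@[simp]
lemma ι_π (i : ℤ) : ι N i ≫ π N i = 0 := biprod.inl_snd

@[simp]
lemma σ_π (i : ℤ) : σ N i ≫ π N i = 𝟙 _ := biprod.inr_snd

lemma shortExact (i : ℤ) : (ShortComplex.mk (ι N i) (π N i) (ι_π N i)).ShortExact :=
  shortExact_biprod _ _

@[simp]
lemma d_eq (i : ℤ) : (diskSum N).d (i + 1) i = π N (i + 1) ≫ ι N i :=
  (spliceComplex_d _ i).trans (congrArg (π N (i + 1) ≫ ·) (Category.id_comp (ι N i)))

lemma acyclic : (diskSum N).Acyclic :=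
  acyclic_spliceComplex _ fun _ ↦ shortExact_biprod _ _

lemma nonempty_iso_cycles (i : ℤ) : Nonempty (N (i + 1) ≅ (diskSum N).cycles i) := by
  obtain ⟨e⟩ := nonempty_iso_image_spliceComplex
    (S := fun i ↦ .mk (biprod.inl : N (i + 1) ⟶ N (i + 1) ⊞ N i) biprod.snd biprod.inl_snd)
    (fun _ ↦ Iso.refl _) (fun _ ↦ shortExact_biprod _ _) i
  obtain ⟨e'⟩ := nonempty_cycles_iso_image (i := i + 1) rfl (acyclic N i)
  exact ⟨e ≪≫ e'.symm⟩

variable {N} {Y : ChainComplex A ℤ}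

lemma ι_eq (i : ℤ) : ι N i = σ N (i + 1) ≫ (diskSum N).d (i + 1) i := by
  rw [d_eq, reassoc_of% σ_π]

lemma hom_ext_X {i : ℤ} {Z : A} {f g : (diskSum N).X i ⟶ Z} (h₁ : ι N i ≫ f = ι N i ≫ g)
    (h₂ : σ N i ≫ f = σ N i ≫ g) : f = g :=
  biprod.hom_ext' (X := N (i + 1)) (Y := N i) f g h₁ h₂

lemma ι_comp_f (f : diskSum N ⟶ Y) (i : ℤ) :
    ι N i ≫ f.f i = σ N (i + 1) ≫ f.f (i + 1) ≫ Y.d (i + 1) i := by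
  rw [ι_eq, Category.assoc, ← f.comm]

lemma hom_ext {f g : diskSum N ⟶ Y} (h : ∀ i, σ N i ≫ f.f i = σ N i ≫ g.f i) : f = g := by
  ext i
  refine hom_ext_X ?_ (h i)
  rw [ι_comp_f, ι_comp_f, reassoc_of% h (i + 1)]

/-- The morphism out of a term of `diskSum N` with given components. -/
noncomputable def descX {i : ℤ} {Z : A} (a : N (i + 1) ⟶ Z) (b : N i ⟶ Z) : (diskSum N).X i ⟶ Z :=
  (biprod.desc a b : N (i + 1) ⊞ N i ⟶ Z)

@[simp]
lemma ι_descX {i : ℤ} {Z : A} (a : N (i + 1) ⟶ Z) (b : N i ⟶ Z) : ι N i ≫ descX a b = a :=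
  biprod.inl_desc _ _

@[simp]
lemma σ_descX {i : ℤ} {Z : A} (a : N (i + 1) ⟶ Z) (b : N i ⟶ Z) : σ N i ≫ descX a b = b :=
  biprod.inr_desc _ _

/-- The morphism from a direct sum of disks corresponding to a morphism of graded objects:
`diskSum` is left adjoint to forgetting the differential. -/
noncomputable def desc (a : ∀ i, N i ⟶ Y.X i) : diskSum N ⟶ Y where
  f i := descX (a (i + 1) ≫ Y.d (i + 1) i) (a i)
  comm' i j h := by
    obtain rfl : j + 1 = i := h
    exact hom_ext_X (by simp [reassoc_of% ι_descX, reassoc_of% ι_π])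
      (by simp [reassoc_of% σ_descX, reassoc_of% σ_π])

@[simp]
lemma σ_desc (a : ∀ i, N i ⟶ Y.X i) (i : ℤ) : σ N i ≫ (desc a).f i = a i :=
  σ_descX _ _

/-- The action of `diskSum` on morphisms of graded objects. -/
noncomputable def map {N' : ℤ → A} (a : ∀ i, N i ⟶ N' i) : diskSum N ⟶ diskSum N' :=
  desc fun i ↦ a i ≫ σ N' i

lemma map_f {N' : ℤ → A} (a : ∀ i, N i ⟶ N' i) (i : ℤ) :
    (map a).f i =
      (biprod.map (a (i + 1)) (a i) : N (i + 1) ⊞ N i ⟶ N' (i + 1) ⊞ N' i) := by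
  refine hom_ext_X ?_ ((σ_desc _ i).trans (biprod.inr_map _ _).symm)
  rw [ι_comp_f, map, reassoc_of% σ_desc, Category.assoc, ← ι_eq]
  exact (biprod.inl_map _ _).symm

lemma map_shortExact {S : ℤ → ShortComplex A} (hS : ∀ i, (S i).ShortExact) :
    (ShortComplex.mk (map fun i ↦ (S i).f) (map fun i ↦ (S i).g)
      (hom_ext fun i ↦ by simp [map, reassoc_of% σ_desc, (S i).zero_assoc])).ShortExact :=
  HomologicalComplex.shortExact_of_degreewise_shortExact _ fun i ↦
    shortExact_of_eq_biprod_map (hS (i + 1)) (hS i) (map_f (fun i ↦ (S i).f) i)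
      (map_f (fun i ↦ (S i).g) i) _

lemma projective (h : ∀ i, Projective (N i)) : Projective (diskSum N) where
  factors {E Y} f e _ :=
    ⟨desc fun i ↦ Projective.factorThru (σ N i ≫ f.f i) (e.f i),
      hom_ext fun i ↦ by simp [reassoc_of% σ_desc]⟩

lemma exists_epi [EnoughProjectives A] (X : ChainComplex A ℤ) :
    ∃ (N : ℤ → A) (p : diskSum N ⟶ X), (∀ i, Projective (N i)) ∧ Epi p :=
  ⟨fun i ↦ Projective.over (X.X i), desc fun i ↦ Projective.π (X.X i), fun _ ↦ inferInstance,
    HomologicalComplex.epi_of_epi_f _ fun i ↦ epi_of_epi_fac (σ_desc _ i)⟩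

variable [HasExt.{w'} A]

lemma extVanishes [EnoughProjectives A] [HasExt.{w''} (ChainComplex A ℤ)]
    (h : ∀ i, ExtVanishes (N i) (Y.X i)) : ExtVanishes (diskSum N) Y := by
  refine .of_dimension_shift
    (𝒯 := fun X ↦ ∃ N, (∀ i, ExtVanishes (N i) (Y.X i)) ∧ Nonempty (diskSum N ≅ X)) ?_
    ⟨N, h, ⟨Iso.refl _⟩⟩
  rintro X ⟨N, hN, ⟨e⟩⟩
  let S (i : ℤ) : ShortComplex A := .mk _ (Projective.π (N i)) (kernel.condition _)
  have hS (i : ℤ) : (S i).ShortExact := { exact := ShortComplex.exact_kernel _ }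
  have hP : Projective (diskSum fun i ↦ (S i).X₂) :=
    projective fun i ↦ inferInstanceAs (Projective (Projective.over (N i)))
  refine ⟨_, map_shortExact hS, ⟨e⟩, ⟨fun i ↦ (S i).X₁, fun i ↦ ?_, ⟨Iso.refl _⟩⟩,
    .of_projective _ _, fun φ ↦ ?_⟩
  · exact .of_shortExact₁ (hS i) (.of_projective (Projective.over (N i)) _) (hN i)
  · choose ψ hψ using fun i ↦
      exists_extension_of_subsingleton_ext (hS i) (hN i 0) (σ (fun i ↦ (S i).X₁) i ≫ φ.f i)
    have hφ : map (fun i ↦ (S i).f) ≫ desc ψ = φ :=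
      hom_ext fun i ↦ by simp [map, reassoc_of% σ_desc, hψ]
    exact ⟨desc ψ, hφ⟩

lemma nonempty_iso_of_acyclic {X : ChainComplex A ℤ} (hX : X.Acyclic)
    (e : ∀ i, N (i + 1) ≅ X.cycles i) (h : ∀ i, Subsingleton (Ext (N i) (X.cycles i) 1)) :
    Nonempty (X ≅ diskSum N) := by
  have key (i : ℤ) : ∃ a : N i ⟶ X.X i, ∀ j, j + 1 = i → IsIso (a ≫ X.toCycles i j) := by
    obtain ⟨j, rfl⟩ : ∃ j, i = j + 1 := ⟨i - 1, by lia⟩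
    obtain ⟨a, ha⟩ := exists_lift_of_subsingleton_ext
      (shortExact_cycles (i := j + 1) (j := j) rfl (hX j)) (h _) (e j).hom
    refine ⟨a, fun k hk ↦ ?_⟩
    obtain rfl : k = j := by lia
    dsimp only at ha
    rw [ha]
    infer_instance
  choose a ha using key
  have (i : ℤ) : IsIso ((desc a).f i) := by
    obtain ⟨j, rfl⟩ : ∃ j, i = j + 1 := ⟨i - 1, by lia⟩
    let φ : ShortComplex.mk (ι N (j + 1)) (π N (j + 1)) (ι_π _ _) ⟶
        .mk (X.iCycles (j + 1)) (X.toCycles (j + 1) j) (iCycles_toCycles _ _) :=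
      { τ₁ := a (j + 1 + 1) ≫ X.toCycles _ (j + 1)
        τ₂ := (desc a).f (j + 1)
        τ₃ := a (j + 1) ≫ X.toCycles _ j
        comm₁₂ := by rw [ι_comp_f, reassoc_of% σ_desc, Category.assoc, X.toCycles_i]
        comm₂₃ := hom_ext_X
          (by rw [reassoc_of% ι_comp_f, X.d_toCycles, comp_zero, comp_zero, reassoc_of% ι_π,
            zero_comp])
          (by simp [reassoc_of% σ_desc, reassoc_of% σ_π]) }
    exact ShortComplex.isIso₂_of_shortExact_of_isIso₁₃' φ (shortExact N _)
      (shortExact_cycles rfl (hX j)) (ha _ _ rfl) (ha _ _ rfl)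
  have := HomologicalComplex.Hom.isIso_of_components (desc a)
  exact ⟨(asIso (desc a)).symm⟩

end diskSum

end DiskSum

section LinearAlgebra

open TensorProduct

variable {R : Type*} [CommRing R] {C K P M : Type*} [AddCommGroup C] [AddCommGroup K]
  [AddCommGroup P] [AddCommGroup M] [Module R C] [Module R K] [Module R P] [Module R M]

variable (R C M) in
/-- A module `M` is reflexive with respect to `C` if the biduality map `M → Hom(Hom(M, C), C)` is
bijective. -/
def IsReflexiveWrt : Prop :=
  Function.Bijective (LinearMap.applyₗ : M →ₗ[R] (M →ₗ[R] C) →ₗ[R] C)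

namespace IsReflexiveWrt

lemma of_retract (hP : IsReflexiveWrt R C P) {i : M →ₗ[R] P} {p : P →ₗ[R] M}
    (h : p ∘ₗ i = LinearMap.id) : IsReflexiveWrt R C M := by
  have hpi (x : M) : p (i x) = x := LinearMap.congr_fun h x
  refine ⟨(injective_iff_map_eq_zero _).2 fun x hx ↦ ?_, fun ψ ↦ ?_⟩
  · have : i x = 0 := (injective_iff_map_eq_zero _).1 hP.1 _ <|
      LinearMap.ext fun φ ↦ LinearMap.congr_fun hx (φ ∘ₗ i)
    rw [← hpi x, this, map_zero]
  · obtain ⟨y, hy⟩ := hP.2 (ψ ∘ₗ LinearMap.lcomp R C i)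
    refine ⟨p y, LinearMap.ext fun φ ↦ (LinearMap.congr_fun hy (φ ∘ₗ p)).trans ?_⟩
    change ψ ((φ ∘ₗ p) ∘ₗ i) = ψ φ
    rw [LinearMap.comp_assoc, h, LinearMap.comp_id]

lemma of_exact (hP : IsReflexiveWrt R C P)
    (hM : Function.Injective (LinearMap.applyₗ : M →ₗ[R] (M →ₗ[R] C) →ₗ[R] C))
    {i : K →ₗ[R] P} {p : P →ₗ[R] M} (hi : Function.Injective i) (hip : Function.Exact i p)
    (hext : Function.Surjective (LinearMap.lcomp R C i)) : IsReflexiveWrt R C K := by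
  refine ⟨(injective_iff_map_eq_zero _).2 fun x hx ↦ ?_, fun ψ ↦ ?_⟩
  · have hPi : Function.Injective
        ((LinearMap.applyₗ : P →ₗ[R] (P →ₗ[R] C) →ₗ[R] C) ∘ₗ i) := hP.1.comp hi
    exact (injective_iff_map_eq_zero _).1 hPi _ <|
      LinearMap.ext fun φ ↦ LinearMap.congr_fun hx (φ ∘ₗ i)
  · obtain ⟨y, hy⟩ := hP.2 (ψ ∘ₗ LinearMap.lcomp R C i)
    have hpy : p y = 0 := (injective_iff_map_eq_zero _).1 hM _ <| LinearMap.ext fun φ ↦ by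
      refine (LinearMap.congr_fun hy (φ ∘ₗ p)).trans ?_
      change ψ ((φ ∘ₗ p) ∘ₗ i) = 0
      rw [LinearMap.comp_assoc, hip.linearMap_comp_eq_zero, LinearMap.comp_zero, map_zero]
    obtain ⟨x, rfl⟩ := (hip y).1 hpy
    refine ⟨x, LinearMap.ext fun φ ↦ ?_⟩
    obtain ⟨φ, rfl⟩ := hext φ
    exact LinearMap.congr_fun hy φ

variable (hC : Function.Bijective (LinearMap.lsmul R C : R → C →ₗ[R] C))
include hC

lemma self : IsReflexiveWrt R C C := by
  refine ⟨(injective_iff_map_eq_zero _).2 fun x hx ↦ LinearMap.congr_fun hx LinearMap.id,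
    fun ψ ↦ ⟨ψ LinearMap.id, LinearMap.ext fun φ ↦ ?_⟩⟩
  obtain ⟨r, rfl⟩ := hC.2 φ
  exact (map_smul ψ r LinearMap.id).symm

lemma pi (ι : Type*) [Finite ι] : IsReflexiveWrt R C (ι → R) := by
  classical
  have := Fintype.ofFinite ι
  refine ⟨(injective_iff_map_eq_zero _).2 fun x hx ↦ funext fun k ↦ hC.1 <|
    LinearMap.ext fun c ↦ ?_, fun ψ ↦ ?_⟩
  · simpa using LinearMap.congr_fun hx (LinearMap.toSpanSingleton R C c ∘ₗ LinearMap.proj k)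
  · let e := (LinearEquiv.piRing R C ι R).symm
    choose x hx using fun k ↦ hC.2 (ψ ∘ₗ e.toLinearMap ∘ₗ LinearMap.single R (fun _ ↦ C) k)
    suffices LinearMap.applyₗ x ∘ₗ e.toLinearMap = ψ ∘ₗ e.toLinearMap from
      ⟨x, (LinearMap.cancel_right e.surjective).1 this⟩
    refine LinearMap.pi_ext fun k c ↦ Eq.trans ?_ (LinearMap.congr_fun (hx k) c)
    simp [e, LinearEquiv.piRing_symm_apply, Pi.single_apply]

lemma of_projective [Module.Finite R P] [Module.Projective R P] : IsReflexiveWrt R C P :=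
  have ⟨n, _, _, _, _, h⟩ := Module.Finite.exists_comp_eq_id_of_projective R P
  (pi hC (Fin n)).of_retract h

end IsReflexiveWrt

lemma rTensorHomToHomRTensor_lcomp (F : Type*) [AddCommGroup F] [Module R F] (f : K →ₗ[R] M)
    (t : (M →ₗ[R] C) ⊗[R] F) :
    rTensorHomToHomRTensor (RingHom.id R) K C F ((LinearMap.lcomp R C f).rTensor F t) =
      rTensorHomToHomRTensor (RingHom.id R) M C F t ∘ₗ f := by
  induction t with
  | zero => simp
  | tmul φ x => ext; simp
  | add s t hs ht => rw [map_add, map_add, hs, ht, map_add, LinearMap.add_comp]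

lemma rTensorHomToHomRTensor_surjective (F : Type*) [AddCommGroup F] [Module R F] [Module.Flat R F]
    [Module.FinitePresentation R M] :
    Function.Surjective (rTensorHomToHomRTensor (RingHom.id R) M C F) := by
  intro φ
  obtain ⟨n, m, f, g, hf, hgf⟩ := Module.FinitePresentation.exists_fin' R M
  have hexact : Function.Exact (LinearMap.lcomp R C f) (LinearMap.lcomp R C g) :=
    LinearMap.exact_lcomp_of_exact_of_surjective C hgf hf
  have hbij (k : ℕ) :
      Function.Bijective (rTensorHomToHomRTensor (RingHom.id R) (Fin k → R) C F) := by
    rw [← LinearMap.coe_coe, ← rTensorHomEquivHomRTensor_toLinearMap]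
    exact (rTensorHomEquivHomRTensor R (Fin k → R) C F).bijective
  obtain ⟨t, ht⟩ := (hbij n).2 (φ ∘ₗ f)
  have hgt : (LinearMap.lcomp R C g).rTensor F t = 0 := (hbij m).1 <| by
    rw [rTensorHomToHomRTensor_lcomp, ht, map_zero, LinearMap.comp_assoc,
      hgf.linearMap_comp_eq_zero, LinearMap.comp_zero]
  obtain ⟨s, rfl⟩ := (Module.Flat.rTensor_exact F hexact t).1 hgt
  rw [rTensorHomToHomRTensor_lcomp] at ht
  exact ⟨s, (LinearMap.cancel_right hf).1 ht⟩

lemma lcomp_tensorProduct_surjective (F : Type*) [AddCommGroup F] [Module R F] [Module.Flat R F]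
    [Module.FinitePresentation R K] {i : K →ₗ[R] P}
    (hi : Function.Surjective (LinearMap.lcomp R C i)) :
    Function.Surjective (LinearMap.lcomp R (C ⊗[R] F) i) := by
  intro φ
  obtain ⟨t, rfl⟩ := rTensorHomToHomRTensor_surjective F φ
  obtain ⟨s, rfl⟩ := LinearMap.rTensor_surjective F hi t
  exact ⟨_, (rTensorHomToHomRTensor_lcomp F i s).symm⟩

lemma lcomp_lcomp_surjective {p : P →ₗ[R] M} (hp : Function.Surjective p)
    (hM : Function.Surjective (LinearMap.applyₗ : M →ₗ[R] (M →ₗ[R] C) →ₗ[R] C)) :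
    Function.Surjective (LinearMap.lcomp R C (LinearMap.lcomp R C p)) := by
  intro ψ
  obtain ⟨x, rfl⟩ := hM ψ
  obtain ⟨y, rfl⟩ := hp x
  exact ⟨LinearMap.applyₗ y, rfl⟩

lemma finitePresentation_of_exact [Module.Finite R K] [Module.FinitePresentation R P]
    {i : K →ₗ[R] P} {p : P →ₗ[R] M} (hip : Function.Exact i p) (hp : Function.Surjective p) :
    Module.FinitePresentation R M := by
  refine Module.finitePresentation_of_surjective p hp ?_
  rw [hip.linearMap_ker_eq, ← Submodule.map_top]
  exact Module.Finite.fg_top.map _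

lemma finitePresentation_tensorProduct [Module.Projective R P] [Module.Finite R P]
    [Module.FinitePresentation R M] : Module.FinitePresentation R (P ⊗[R] M) := by
  obtain ⟨n, m, f, g, hf, hgf⟩ := Module.FinitePresentation.exists_fin' R M
  have := Module.finitePresentation_of_projective R (P ⊗[R] (Fin n → R))
  exact finitePresentation_of_exact (lTensor_exact P hgf hf) (LinearMap.lTensor_surjective P hf)

end LinearAlgebra

section Syzygies

variable {A : Type w} [Category.{v} A] [Abelian A] {Z : A} (P : ProjectiveResolution Z)

/-- The syzygies of `Z` computed by a projective resolution `P`, with `syzygy P 0 ≅ Z`; they are the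
cokernels of the differentials of `P`. -/
noncomputable def syzygy (n : ℕ) : A := P.complex.opcycles n

/-- The sequence `0 ⟶ syzygy P (n + 1) ⟶ P n ⟶ syzygy P n ⟶ 0`. -/
noncomputable def syzygySequence (n : ℕ) : ShortComplex A :=
  .mk (P.complex.fromOpcycles (n + 1) n) (P.complex.pOpcycles n) (fromOpcycles_pOpcycles _ _)

lemma syzygySequence_shortExact (n : ℕ) : (syzygySequence P n).ShortExact :=
  shortExact_opcycles rfl (P.complex_exactAt_succ n)

lemma nonempty_syzygy_zero_iso : Nonempty (syzygy P 0 ≅ Z) :=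
  ⟨IsColimit.coconePointUniqueUpToIso (P.complex.opcyclesIsCokernel 1 0 (by simp))
    P.isColimitCokernelCofork⟩

lemma extVanishes_syzygy [HasExt.{w'} A] {B : A} (hB : ExtVanishes Z B) (n : ℕ) :
    ExtVanishes (syzygy P n) B := by
  induction n with
  | zero => exact hB.of_iso (nonempty_syzygy_zero_iso P).some.symm
  | succ n ih =>
    exact .of_shortExact₁ (syzygySequence_shortExact P n)
      (.of_projective (P.complex.X n) B : ExtVanishes (syzygySequence P n).X₂ B) ih

end Syzygies

section Modules

open TensorProduct

variable {R : Type u} [CommRing R]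

lemma shortExact_iff_linearMap {S : ShortComplex (ModuleCat.{v} R)} :
    S.ShortExact ↔ Function.Injective S.f.hom ∧ Function.Exact S.f.hom S.g.hom ∧
      Function.Surjective S.g.hom :=
  ⟨fun h ↦ ⟨h.moduleCat_injective_f,
    (ShortComplex.ShortExact.moduleCat_exact_iff_function_exact _).1 h.exact,
    h.moduleCat_surjective_g⟩,
  fun ⟨hi, h, hp⟩ ↦ ModuleCat.shortComplex_shortExact S h hi hp⟩

lemma lcomp_surjective_iff {X Y B : ModuleCat.{v} R} {f : X ⟶ Y} :
    Function.Surjective (LinearMap.lcomp R B f.hom) ↔ ∀ φ : X ⟶ B, ∃ ψ : Y ⟶ B, f ≫ ψ = φ :=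
  ⟨fun h φ ↦ (h φ.hom).imp' ModuleCat.ofHom fun _ hψ ↦ ModuleCat.hom_ext hψ,
    fun h φ ↦ (h (ModuleCat.ofHom φ)).imp' ModuleCat.Hom.hom fun _ hψ ↦
      congr(ModuleCat.Hom.hom $hψ)⟩

/-- The sequence `S ⊗ P`. -/
noncomputable def tensorSequence (S : ShortComplex (ModuleCat.{u} R)) (P : ModuleCat.{u} R) :
    ShortComplex (ModuleCat.{u} R) :=
  .mk (ModuleCat.ofHom (S.f.hom.rTensor P)) (ModuleCat.ofHom (S.g.hom.rTensor P)) <|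
    ModuleCat.hom_ext <| by
      change S.g.hom.rTensor P ∘ₗ S.f.hom.rTensor P = 0
      rw [← LinearMap.rTensor_comp, ← ModuleCat.hom_comp, S.zero, ModuleCat.hom_zero,
        LinearMap.rTensor_zero]

lemma tensorSequence_shortExact {S : ShortComplex (ModuleCat.{u} R)} (hS : S.ShortExact)
    (P : ModuleCat.{u} R) [Module.Flat R P] : (tensorSequence S P).ShortExact := by
  obtain ⟨hi, hip, hp⟩ := shortExact_iff_linearMap.1 hS
  exact shortExact_iff_linearMap.2 ⟨Module.Flat.rTensor_preserves_injective_linearMap _ hi,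
    rTensor_exact P hip hp, LinearMap.rTensor_surjective P hp⟩

lemma ExtVanishes.tensor {N B : ModuleCat.{u} R} (h : ExtVanishes N B) (P : ModuleCat.{u} R)
    [Module.Projective R P] : ExtVanishes (ModuleCat.of R (N ⊗[R] P)) B := by
  refine .of_dimension_shift (𝒯 := fun X ↦ ∃ N : ModuleCat.{u} R, ExtVanishes N B ∧
    Nonempty (ModuleCat.of R (N ⊗[R] P) ≅ X)) ?_ ⟨N, h, ⟨Iso.refl _⟩⟩
  rintro X ⟨N, hN, ⟨e⟩⟩
  let S : ShortComplex (ModuleCat.{u} R) := .mk _ (Projective.π N) (kernel.condition _)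
  have hS : S.ShortExact := { exact := ShortComplex.exact_kernel _ }
  have hS₂ : Projective S.X₂ := inferInstanceAs (Projective (Projective.over N))
  have : Module.Projective R S.X₂ := (IsProjective.iff_projective (R := R) _).2 hS₂
  have : Projective (ModuleCat.of R (S.X₂ ⊗[R] P)) :=
    (IsProjective.iff_projective (R := R) _).1 inferInstance
  refine ⟨tensorSequence S P, tensorSequence_shortExact hS P, ⟨e⟩, ⟨S.X₁, ?_, ⟨Iso.refl _⟩⟩,
    .of_projective (ModuleCat.of R (S.X₂ ⊗[R] P)) B, fun f ↦ ?_⟩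
  · exact .of_shortExact₁ hS (.of_projective S.X₂ B) hN
  · have hsurj := lcomp_surjective_iff.2 (exists_extension_of_subsingleton_ext hS (hN 0))
    obtain ⟨g, hg⟩ := Module.projective_lifting_property _ (TensorProduct.curry f.hom).flip hsurj
    exact ⟨ModuleCat.ofHom (TensorProduct.lift g.flip), ModuleCat.hom_ext <|
      TensorProduct.ext' fun x y ↦ LinearMap.congr_fun (LinearMap.congr_fun hg y) x⟩

end Modules

section FiniteResolutions

open TensorProduct

variable {R : Type u} [CommRing R] {Z : ModuleCat.{u} R} (P : ProjectiveResolution Z)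

lemma module_projective_complex (n : ℕ) : Module.Projective R (P.complex.X n) :=
  (IsProjective.iff_projective (R := R) _).2 (P.projective n)

/-- The sequence `0 ⟶ Hom(syzygy P n, C) ⟶ Hom(P n, C) ⟶ Hom(syzygy P (n + 1), C) ⟶ 0`. -/
noncomputable def dualSequence (C : ModuleCat.{u} R) (n : ℕ) : ShortComplex (ModuleCat.{u} R) :=
  .mk (X₁ := .of R ((syzygy P n : ModuleCat.{u} R) →ₗ[R] C)) (X₂ := .of R (P.complex.X n →ₗ[R] C))
    (X₃ := .of R ((syzygy P (n + 1) : ModuleCat.{u} R) →ₗ[R] C))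
    (ModuleCat.ofHom (LinearMap.lcomp R C (syzygySequence P n).g.hom))
    (ModuleCat.ofHom (LinearMap.lcomp R C (syzygySequence P n).f.hom)) <|
    ModuleCat.hom_ext <| LinearMap.ext fun φ ↦
      congr(φ ∘ₗ ModuleCat.Hom.hom $((syzygySequence P n).zero)).trans φ.comp_zero

variable {C : ModuleCat.{u} R} (h : ExtVanishes Z C)

section

include h

lemma lcomp_syzygy_surjective (n : ℕ) :
    Function.Surjective (LinearMap.lcomp R C (syzygySequence P n).f.hom) :=
  lcomp_surjective_iff.2
    (exists_extension_of_subsingleton_ext (syzygySequence_shortExact P n)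
      (extVanishes_syzygy P h n 0))

lemma dualSequence_shortExact (n : ℕ) : (dualSequence P C n).ShortExact := by
  obtain ⟨-, hip, hp⟩ := shortExact_iff_linearMap.1 (syzygySequence_shortExact P n)
  exact shortExact_iff_linearMap.2 ⟨LinearMap.lcomp_injective_of_surjective _ hp,
    LinearMap.exact_lcomp_of_exact_of_surjective C hip hp, lcomp_syzygy_surjective P h n⟩

end

variable [∀ n, Module.Finite R (P.complex.X n)]

lemma finite_syzygy (n : ℕ) : Module.Finite R (syzygy P n : ModuleCat.{u} R) :=
  have : Module.Finite R (syzygySequence P n).X₂ :=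
    inferInstanceAs (Module.Finite R (P.complex.X n))
  .of_surjective _ (shortExact_iff_linearMap.1 (syzygySequence_shortExact P n)).2.2

lemma finitePresentation_syzygy (n : ℕ) :
    Module.FinitePresentation R (syzygy P n : ModuleCat.{u} R) := by
  obtain ⟨-, hip, hp⟩ := shortExact_iff_linearMap.1 (syzygySequence_shortExact P n)
  have := module_projective_complex P n
  have : Module.Finite R (syzygySequence P n).X₁ := finite_syzygy P (n + 1)
  have : Module.FinitePresentation R (syzygySequence P n).X₂ :=
    Module.finitePresentation_of_projective R (P.complex.X n)
  exact finitePresentation_of_exact hip hp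

include P h

lemma ExtVanishes.tensorProduct_flat (F : ModuleCat.{u} R) [Module.Flat R F] :
    ExtVanishes Z (ModuleCat.of R (C ⊗[R] F)) := by
  obtain ⟨e⟩ := nonempty_syzygy_zero_iso P
  refine of_dimension_shift (𝒯 := fun X ↦ ∃ n : ℕ, Nonempty (syzygy P n ≅ X)) ?_ ⟨0, ⟨e⟩⟩
  rintro X ⟨n, ⟨e⟩⟩
  have : Module.FinitePresentation R (syzygySequence P n).X₁ := finitePresentation_syzygy P (n + 1)
  exact ⟨syzygySequence P n, syzygySequence_shortExact P n, ⟨e⟩, ⟨n + 1, ⟨Iso.refl _⟩⟩,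
    .of_projective (P.complex.X n) _, lcomp_surjective_iff.1
      (lcomp_tensorProduct_surjective F (lcomp_syzygy_surjective P h n))⟩

lemma isReflexiveWrt_syzygy (hC : Function.Bijective (LinearMap.lsmul R C : R → C →ₗ[R] C))
    (hZ : IsReflexiveWrt R C Z) (n : ℕ) : IsReflexiveWrt R C (syzygy P n : ModuleCat.{u} R) := by
  induction n with
  | zero =>
    obtain ⟨e⟩ := nonempty_syzygy_zero_iso P
    exact hZ.of_retract (i := e.hom.hom) (p := e.inv.hom) congr(ModuleCat.Hom.hom $(e.hom_inv_id))
  | succ n ih =>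
    obtain ⟨hi, hip, -⟩ := shortExact_iff_linearMap.1 (syzygySequence_shortExact P n)
    have := module_projective_complex P n
    exact IsReflexiveWrt.of_exact (P := P.complex.X n) (.of_projective hC) ih.1 hi hip
      (lcomp_syzygy_surjective P h n)

lemma finitePresentation_dual_syzygy [Module.FinitePresentation R C]
    (hZ : Module.FinitePresentation R (Z →ₗ[R] C)) (n : ℕ) :
    Module.FinitePresentation R ((syzygy P n : ModuleCat.{u} R) →ₗ[R] C) := by
  induction n with
  | zero =>
    obtain ⟨e⟩ := nonempty_syzygy_zero_iso P
    exact .of_equiv (LinearEquiv.congrLeft C R e.symm.toLinearEquiv)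
  | succ n ih =>
    obtain ⟨-, hip, hp⟩ := shortExact_iff_linearMap.1 (dualSequence_shortExact P h n)
    have := module_projective_complex P n
    have : Module.FinitePresentation R (Module.Dual R (P.complex.X n) ⊗[R] C) :=
      finitePresentation_tensorProduct
    have : Module.FinitePresentation R (P.complex.X n →ₗ[R] C) :=
      .of_equiv (M := Module.Dual R (P.complex.X n) ⊗[R] C) (dualTensorHomEquiv R _ C)
    have : Module.FinitePresentation R (dualSequence P C n).X₂ := this
    have : Module.FinitePresentation R (dualSequence P C n).X₁ := ih
    exact finitePresentation_of_exact hip hp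

end FiniteResolutions

section CModules

open TensorProduct

variable {R : Type u} [CommRing R] {C : ModuleCat.{u} R}

instance : (projectiveModules R).IsClosedUnderIsomorphisms where
  of_iso e (_ : Module.Projective R _) := Module.Projective.of_equiv e.toLinearEquiv

instance : (cProjectiveModules C).IsClosedUnderIsomorphisms where
  of_iso := fun e ⟨P, hP, ⟨e'⟩⟩ ↦ ⟨P, hP, ⟨e.symm ≪≫ e'⟩⟩

lemma cProjectiveModules_le_cFlatModules : cProjectiveModules C ≤ cFlatModules C :=
  fun _ ⟨P, _, e⟩ ↦ ⟨P, inferInstance, e⟩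

lemma cProjectiveModules_tensor {M : ModuleCat.{u} R} (h : cProjectiveModules C M)
    (P : ModuleCat.{u} R) [Module.Projective R P] :
    cProjectiveModules C (ModuleCat.of R (M ⊗[R] P)) := by
  obtain ⟨Q, hQ, ⟨e⟩⟩ := h
  exact ⟨ModuleCat.of R (Q ⊗[R] P), inferInstanceAs (Module.Projective R (Q ⊗[R] P)),
    ⟨(TensorProduct.congr e.toLinearEquiv (LinearEquiv.refl R P) ≪≫ₗ
      TensorProduct.assoc R C Q P).toModuleIso⟩⟩

lemma cProjectiveModules_hom (P : ModuleCat.{u} R) [Module.Projective R P] [Module.Finite R P] :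
    cProjectiveModules C (ModuleCat.of R (P →ₗ[R] C)) :=
  ⟨ModuleCat.of R (Module.Dual R P), inferInstanceAs (Module.Projective R (Module.Dual R P)),
    ⟨((dualTensorHomEquiv R P C).symm ≪≫ₗ TensorProduct.comm R _ _).toModuleIso⟩⟩

lemma cProjectiveModules_biprod {M M' : ModuleCat.{u} R} (h : cProjectiveModules C M)
    (h' : cProjectiveModules C M') : cProjectiveModules C (M ⊞ M') := by
  obtain ⟨P, hP, ⟨e⟩⟩ := h
  obtain ⟨P', hP', ⟨e'⟩⟩ := h'
  exact ⟨ModuleCat.of R (P × P'), inferInstanceAs (Module.Projective R (P × P')),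
    ⟨biprod.mapIso e e' ≪≫ ModuleCat.biprodIsoProd _ _ ≪≫
      (TensorProduct.prodRight R R C P P').symm.toModuleIso⟩⟩

namespace IsSemidualizing

variable (hC : IsSemidualizing C)
include hC

lemma extVanishes : ExtVanishes C C := fun n ↦ hC.ext_eq_zero (n + 1) (by lia)

lemma extVanishes_cFlatModules {M B : ModuleCat.{u} R} (hM : cProjectiveModules C M)
    (hB : cFlatModules C B) : ExtVanishes M B := by
  obtain ⟨P, hP⟩ := hC.exists_resolution
  obtain ⟨Q, hQ, ⟨e⟩⟩ := hM
  obtain ⟨F, hF, ⟨e'⟩⟩ := hB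
  exact (((hC.extVanishes.tensorProduct_flat P F).tensor Q).of_iso e.symm).of_iso_target e'.symm

lemma nonempty_iso_hom_self : Nonempty (ModuleCat.of R R ≅ ModuleCat.of R (C →ₗ[R] C)) :=
  ⟨(LinearEquiv.ofBijective _ hC.homothety_bijective).toModuleIso⟩

lemma nonempty_iso_hom_syzygy_zero (P : ProjectiveResolution C) :
    Nonempty (ModuleCat.of R R ≅ .of R ((syzygy P 0 : ModuleCat.{u} R) →ₗ[R] C)) := by
  obtain ⟨e⟩ := nonempty_syzygy_zero_iso P
  obtain ⟨e'⟩ := hC.nonempty_iso_hom_self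
  exact ⟨e' ≪≫ (LinearEquiv.congrLeft C R e.symm.toLinearEquiv).toModuleIso⟩

section

variable (P : ProjectiveResolution C) [∀ n, Module.Finite R (P.complex.X n)]

lemma finitePresentation_hom_syzygy (n : ℕ) :
    Module.FinitePresentation R ((syzygy P n : ModuleCat.{u} R) →ₗ[R] C) := by
  obtain ⟨e⟩ := nonempty_syzygy_zero_iso P
  obtain ⟨e'⟩ := hC.nonempty_iso_hom_self
  have := finitePresentation_syzygy P 0
  have : Module.FinitePresentation R C := .of_equiv e.toLinearEquiv
  exact finitePresentation_dual_syzygy P hC.extVanishes (.of_equiv e'.toLinearEquiv) n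

/-- The sequence dual to `0 ⟶ syzygy P (n + 1) ⟶ P n ⟶ syzygy P n ⟶ 0` stays exact under
`Hom(-, C)` because its double dual is the sequence itself. -/
lemma extVanishes_dual_syzygy {B : ModuleCat.{u} R} (hB : cFlatModules C B) (n : ℕ) :
    ExtVanishes (ModuleCat.of R ((syzygy P n : ModuleCat.{u} R) →ₗ[R] C)) B := by
  induction n with
  | zero =>
    obtain ⟨e⟩ := hC.nonempty_iso_hom_syzygy_zero P
    exact (ExtVanishes.of_projective _ B).of_iso e
  | succ n ih =>
    obtain ⟨F, hF, ⟨e⟩⟩ := hB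
    have := module_projective_complex P n
    have hp := (shortExact_iff_linearMap.1 (syzygySequence_shortExact P n)).2.2
    have : Module.FinitePresentation R (dualSequence P C n).X₁ :=
      hC.finitePresentation_hom_syzygy P n
    have hrefl : IsReflexiveWrt R C (syzygySequence P n).X₃ :=
      isReflexiveWrt_syzygy P hC.extVanishes hC.homothety_bijective (.self hC.homothety_bijective) n
    refine .of_iso_target (.of_shortExact₃ (dualSequence_shortExact P hC.extVanishes n)
      (ih.of_iso_target e) ?_ ?_) e.symm
    · exact hC.extVanishes_cFlatModules (cProjectiveModules_hom (P.complex.X n))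
        ⟨F, hF, ⟨Iso.refl _⟩⟩
    · exact lcomp_surjective_iff.1
        (lcomp_tensorProduct_surjective F (lcomp_lcomp_surjective hp hrefl.2))

end

/-- The class consists of the modules `N ⊗ P` with `P` projective and `N` a cosyzygy of the
coresolution of `R` by `C`-projective modules obtained by applying `Hom(-, C)` to a resolution of
`C`. -/
theorem exists_coresolving_class : ∃ 𝒩 : ObjectProperty (ModuleCat.{u} R),
    projectiveModules R ≤ 𝒩 ∧ 𝒩 ≤ KernelOfEpi (cProjectiveModules C) 𝒩 ∧
      ∀ N B, 𝒩 N → cFlatModules C B → ExtVanishes N B := by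
  obtain ⟨P, hP⟩ := hC.exists_resolution
  let 𝒩 : ObjectProperty (ModuleCat.{u} R) := fun N ↦ ∃ (n : ℕ) (Q : ModuleCat.{u} R),
    Module.Projective R Q ∧
      Nonempty (.of R (((syzygy P n : ModuleCat.{u} R) →ₗ[R] C) ⊗[R] Q) ≅ N)
  have : 𝒩.IsClosedUnderIsomorphisms := ⟨fun e ⟨n, Q, hQ, ⟨e'⟩⟩ ↦ ⟨n, Q, hQ, ⟨e' ≪≫ e⟩⟩⟩
  refine ⟨𝒩, ?_, ?_, ?_⟩
  · intro Q hQ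
    obtain ⟨e⟩ := hC.nonempty_iso_hom_syzygy_zero P
    exact ⟨0, Q, hQ, ⟨(TensorProduct.congr e.symm.toLinearEquiv (LinearEquiv.refl R Q) ≪≫ₗ
      TensorProduct.lid R Q).toModuleIso⟩⟩
  · rintro N ⟨n, Q, hQ, ⟨e⟩⟩
    have := module_projective_complex P n
    exact .of_iso e <| .of_shortExact
      (tensorSequence_shortExact (dualSequence_shortExact P hC.extVanishes n) Q)
      (cProjectiveModules_tensor (cProjectiveModules_hom (P.complex.X n)) Q)
      ⟨n + 1, Q, hQ, ⟨Iso.refl _⟩⟩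
  · rintro N B ⟨n, Q, hQ, ⟨e⟩⟩ hB
    exact ((hC.extVanishes_dual_syzygy P hB n).tensor Q).of_iso e

end IsSemidualizing

end CModules

section DiskSums

variable {A : Type w} [Category.{v} A] [Abelian A] {𝒩 𝓠 : ObjectProperty A}

/-- The complexes isomorphic to a direct sum of disks on objects of `𝒩`. -/
def diskSums (𝒩 : ObjectProperty A) : ObjectProperty (ChainComplex A ℤ) :=
  fun X ↦ ∃ N : ℤ → A, (∀ i, 𝒩 (N i)) ∧ Nonempty (diskSum N ≅ X)

instance : (diskSums 𝒩).IsClosedUnderIsomorphisms where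
  of_iso := fun e ⟨N, hN, ⟨e'⟩⟩ ↦ ⟨N, hN, ⟨e' ≪≫ e⟩⟩

lemma diskSums_mono (h : 𝒩 ≤ 𝓠) : diskSums 𝒩 ≤ diskSums 𝓠 :=
  fun _ ⟨N, hN, e⟩ ↦ ⟨N, fun i ↦ h _ (hN i), e⟩

lemma diskSums_le_kernelOfEpi (h : 𝒩 ≤ KernelOfEpi 𝓠 𝒩) :
    diskSums 𝒩 ≤ KernelOfEpi (diskSums 𝓠) (diskSums 𝒩) := by
  rintro X ⟨N, hN, ⟨e⟩⟩
  choose Q f hf hQ hcoker using fun i ↦ h _ (hN i)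
  exact .of_iso e <| .of_shortExact (diskSum.map_shortExact
    (S := fun i ↦ .mk (f i) (cokernel.π (f i)) (cokernel.condition _))
    fun i ↦ { exact := ShortComplex.exact_cokernel (f i) })
    ⟨Q, hQ, ⟨Iso.refl _⟩⟩ ⟨_, hcoker, ⟨Iso.refl _⟩⟩

lemma projective_of_diskSums (h : ∀ P, 𝒩 P → Projective P) {X : ChainComplex A ℤ}
    (hX : diskSums 𝒩 X) : Projective X := by
  obtain ⟨N, hN, ⟨e⟩⟩ := hX
  have := diskSum.projective fun i ↦ h _ (hN i)
  exact Projective.of_iso e this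

end DiskSums

section ComplexesOf

variable {R : Type u} [CommRing R] {𝒳 𝒴 : ObjectProperty (ModuleCat.{u} R)}
  {X Y : ChainComplex (ModuleCat.{u} R) ℤ}

lemma complexesOf_mono (h : 𝒳 ≤ 𝒴) : complexesOf 𝒳 ≤ complexesOf 𝒴 :=
  fun _ hX ↦ ⟨hX.1, fun i ↦ h _ (hX.2 i)⟩

lemma diskSums_le_complexesOf [𝒳.IsClosedUnderIsomorphisms] : diskSums 𝒳 ≤ complexesOf 𝒳 :=
  fun _ ⟨N, hN, ⟨e⟩⟩ ↦ ⟨fun i ↦ (diskSum.acyclic N i).of_iso e, fun i ↦ by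
    obtain ⟨e'⟩ := diskSum.nonempty_iso_cycles N i
    exact 𝒳.prop_of_iso
      (e' ≪≫ (HomologicalComplex.cyclesFunctor _ _ i).mapIso e) (hN (i + 1))⟩

lemma complexesOf_le_diskSums (h : ∀ M N, 𝒳 M → 𝒳 N → ExtVanishes M N) :
    complexesOf 𝒳 ≤ diskSums 𝒳 := fun X hX ↦ by
  obtain ⟨e⟩ := diskSum.nonempty_iso_of_acyclic (N := fun i ↦ X.cycles (i - 1)) hX.1
    (fun i ↦ eqToIso (by simp)) fun i ↦ h _ _ (hX.2 _) (hX.2 _) 0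
  exact ⟨_, fun i ↦ hX.2 _, ⟨e.symm⟩⟩

lemma complexesOf_projectiveModules_le_diskSums :
    complexesOf (projectiveModules R) ≤ diskSums (projectiveModules R) :=
  complexesOf_le_diskSums fun P N hP _ ↦
    have : Projective P := (IsProjective.iff_projective (R := R) P).1 hP
    .of_projective P N

lemma projective_of_complexesOf (hX : complexesOf (projectiveModules R) X) : Projective X :=
  projective_of_diskSums (fun P ↦ (IsProjective.iff_projective (R := R) P).1)
    (complexesOf_projectiveModules_le_diskSums X hX)

lemma exists_epi_of_complexesOf_projectiveModules (X : ChainComplex (ModuleCat.{u} R) ℤ) :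
    ∃ (P : ChainComplex (ModuleCat.{u} R) ℤ) (p : P ⟶ X),
      complexesOf (projectiveModules R) P ∧ Epi p := by
  obtain ⟨N, p, hN, hp⟩ := diskSum.exists_epi X
  exact ⟨_, p, diskSums_le_complexesOf _ ⟨N, fun i ↦
    (IsProjective.iff_projective (R := R) (N i)).2 (hN i), ⟨Iso.refl _⟩⟩, hp⟩

lemma complexesOf_biprod [𝒳.IsClosedUnderIsomorphisms]
    (h : ∀ M N, 𝒳 M → 𝒳 N → 𝒳 (M ⊞ N)) (hX : complexesOf 𝒳 X) (hY : complexesOf 𝒳 Y) :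
    complexesOf 𝒳 (X ⊞ Y) := by
  refine ⟨(shortExact_biprod X Y).acyclic_X₂ hX.1 hY.1, fun i ↦ ?_⟩
  let F := HomologicalComplex.cyclesFunctor (ModuleCat.{u} R) (.down ℤ) i
  have := preservesBinaryBiproducts_of_preservesBiproducts F
  exact 𝒳.prop_of_iso (F.mapBiprod X Y).symm (h _ _ (hX.2 i) (hY.2 i))

lemma extVanishes_of_diskSums [HasExt.{w''} (ChainComplex (ModuleCat.{u} R) ℤ)]
    (h : ∀ M N, 𝒳 M → 𝒴 N → ExtVanishes M N) (hX : diskSums 𝒳 X) (hY : complexesOf 𝒴 Y) :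
    ExtVanishes X Y := by
  obtain ⟨N, hN, ⟨e⟩⟩ := hX
  refine (diskSum.extVanishes fun i ↦ ?_).of_iso e
  exact .of_shortExact_target (shortExact_cycles (i := i) (j := i - 1) (by simp) (hY.1 _))
    (h _ _ (hN i) (hY.2 i)) (h _ _ (hN i) (hY.2 _))

end ComplexesOf

theorem IsSemidualizing.isDCProjectiveComplex_cycles {R : Type u} [CommRing R]
    {C : ModuleCat.{u} R} (hC : IsSemidualizing C)
    {W : ChainComplex (ChainComplex (ModuleCat.{u} R) ℤ) ℤ} (hW : W.Acyclic)
    (hW' : IsHomExact (complexesOf (cFlatModules C)) W)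
    (hPQ : ∀ i : ℤ, complexesOf (projectiveModules R) (W.X i) ∨
      complexesOf (cProjectiveModules C) (W.X i)) (j : ℤ) :
    IsDCProjectiveComplex C (W.cycles j) := by
  let := HasExt.standard (ChainComplex (ModuleCat.{u} R) ℤ)
  obtain ⟨𝒩, h𝓟𝒩, h𝒩, hExt⟩ := hC.exists_coresolving_class
  have h𝓠 : complexesOf (cProjectiveModules C) ≤ diskSums (cProjectiveModules C) :=
    complexesOf_le_diskSums fun M N hM hN ↦
      hC.extVanishes_cFlatModules hM (cProjectiveModules_le_cFlatModules N hN)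
  have hExt𝓠 (Q B) (hQ : complexesOf (cProjectiveModules C) Q)
      (hB : complexesOf (cFlatModules C) B) : ExtVanishes Q B :=
    extVanishes_of_diskSums (fun _ _ ↦ hC.extVanishes_cFlatModules) (h𝓠 Q hQ) hB
  exact hasCompleteResolution_cycles (𝒟 := diskSums 𝒩) (fun _ ↦ projective_of_complexesOf)
    exists_epi_of_complexesOf_projectiveModules
    (fun _ _ ↦ complexesOf_biprod fun _ _ ↦ cProjectiveModules_biprod)
    (complexesOf_mono cProjectiveModules_le_cFlatModules) hExt𝓠
    (complexesOf_projectiveModules_le_diskSums.trans (diskSums_mono h𝓟𝒩))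
    ((diskSums_le_kernelOfEpi h𝒩).trans (.mono diskSums_le_complexesOf le_rfl))
    (fun _ _ ↦ extVanishes_of_diskSums hExt) hW hW' hPQ j

theorem corollary2p17 {R : Type u} [CommRing R] (C : ModuleCat.{u} R) (hC : IsSemidualizing C)
    (X : ChainComplex (ModuleCat.{u} R) ℤ) :
    IsDCProjectiveComplex C X ↔
      ∃ W : ChainComplex (ChainComplex (ModuleCat.{u} R) ℤ) ℤ,
        W.Acyclic ∧ IsHomExact (complexesOf (cFlatModules C)) W ∧
        (∀ i : ℤ, complexesOf (projectiveModules R) (W.X i) ∨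
          complexesOf (cProjectiveModules C) (W.X i)) ∧
        Nonempty (X ≅ cokernel (W.d 1 0)) := by
  have cycles_iso_cokernel {W : ChainComplex (ChainComplex (ModuleCat.{u} R) ℤ) ℤ}
      (hW : W.Acyclic) : Nonempty (W.cycles (-1) ≅ cokernel (W.d 1 0)) :=
    nonempty_cycles_iso_cokernel (by simp) (by simp) (hW 0) (hW (-1))
  constructor
  · rintro ⟨E, hE, hE', hP, hQ, ⟨e⟩⟩
    obtain ⟨e₁⟩ := nonempty_cycles_iso_image (i := 0) (j := -1) (by simp) (hE (-1))
    obtain ⟨e₂⟩ := cycles_iso_cokernel hE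
    exact ⟨E, hE, hE', fun i ↦ (le_or_gt 0 i).imp (hP i) (hQ i), ⟨e ≪≫ e₁.symm ≪≫ e₂⟩⟩
  · rintro ⟨W, hW, hW', hPQ, ⟨e⟩⟩
    obtain ⟨e₁⟩ := cycles_iso_cokernel hW
    obtain ⟨E, hE, hE', hP, hQ, ⟨e₂⟩⟩ := hC.isDCProjectiveComplex_cycles hW hW' hPQ (-1)
    exact ⟨E, hE, hE', hP, hQ, ⟨e ≪≫ e₁.symm ≪≫ e₂⟩⟩
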